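/- **Theorem (Existence of solutions for networks with one cycle).** *Gas.* A mixture of two constituents with molar masses $M_1,M_2>0$ flows in pipes of uniform diameter $D>0$ with friction coefficient $\lambda_{\rm fr}>0$, at constant temperature $T>0$; $R>0$ is the gas constant. For the mass fraction $\eta\in[0,1]$ of the first constituent let $M(\eta)=\big(\tfrac{\eta}{M_1}+\tfrac{1-\eta}{M_2}\big)^{-1}$. The density is $\rho(\eta,p)=\frac{p\,M(\eta)}{R\,T\,Z(\eta,p)}$ and the speed of sound is $c=\sqrt{\partial p/\partial\rho}$ (at fixed $\eta$). The compressibility factor $Z:[0,1]\times(0,\infty)\to(0,\infty)$ is an arbitrary continuous function which is continuously differentiable in $p$ and satisfies $Z-p\,\partial_pZ>0$ (the density is strictly increasing in $p$) and $p/Z(\eta,p)\to0$ as $p\downarrow0$ (the density vanishes with the pressure). Put $$F(\eta,q,p)=\int_1^p\frac{s}{Z(\eta,s)}\,ds-q^2\,\frac{RT}{M(\eta)}\,\ln\frac{p}{Z(\eta,p)} .$$ A state $(\eta,q,p)$ with $p>0$ is subsonic if $|q|/\rho(\eta,p)<c(\eta,p)$. *Network.* $\mathcal G=(\mathcal V,\mathcal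 E)$ is a finite directed multigraph whose underlying undirected graph is connected and has exactly one cycle. Edge $e$ leads from $f(e)$ to $h(e)$ and is either a compressor ($e\in\mathcal E_{\rm comp}$) or a pipe of length $L_e>0$; no compressor lies on the cycle. *Data.* A node $v^*$ with pressure $p^*>0$; loads $b_v\in\mathbb R$ with $\sum_vb_v=0$ (a supply has $b_v<0$); supply compositions $\zeta_v\in[0,1]$ for all $v$ with $b_v\le0$; compressor ratios $\gamma_e\ge1$ for $e\in\mathcal E_{\rm comp}$. *Model.* A steady state consists of flows $q_e$, nodal mass fractions $\eta_v\in[0,1]$ and nodal pressures $p_v>0$ such that 1. $\sum_{e:h(e)=v}q_e-\sum_{e:f(e)=v}q_e=b_v$ for all $v$; 2. $\eta_e=\eta_{f(e)}$ if $q_e\ge0$, and $\eta_e=\eta_{h(e)}$ if $q_e<0$; 3. (perfect mixing) with $q_e^{\rm in}(v)$ the flow entering $v$ from $e$ and $b_v^-=\max(-b_v,0)$, one has $\eta_v\big(\sum_e q_e^{\rm in}(v)+b_v^-\big)=\sum_e q_e^{\rm in}(v)\,\eta_e+b_v^-\zeta_v$; if no gas enters $v$ at all, then $\eta_v=\zeta_v$;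 4. $p_{v^*}=p^*$, and $p_{h(e)}=\gamma_e\,p_{f(e)}$ for every compressor $e$; 5. $F(\eta_e,q_e,p_{h(e)})-F(\eta_e,q_e,p_{f(e)})=-\frac{\lambda_{\rm fr}}{2D}\frac{RT}{M(\eta_e)}L_e\,q_e|q_e|$ for every pipe $e$. *Subsonic flow.* Assume that the gas flow is subsonic in the following sense. Let $q$ satisfy 1 without circulation (the flows on the cycle are not all nonzero and directed the same way round the cycle), and let $\eta$ satisfy 2 and 3. Follow the pressure from $v^*$ along any path without repeated nodes by solving the equations in 4 and 5 successively, with all pressures in the traversed pipes subsonic. Then the gas does not reach a sonic state in the next pipe of such a path: let $p$ be the pressure reached at the end of that pipe $e$ from which it is entered, and let $p'>0$ be such that all pressures strictly between $p$ and $p'$ are subsonic for $(\eta_e,q_e)$ and that $p,p'$ satisfy the equation in 5 with $L_e$ replaced by some $x\in[0,L_e]$ (with $p$ in the place of $p_{f(e)}$ and $p'$ in that of $p_{h(e)}$ if the pipe is entered at $f(e)$, and the other way round if it is entered at $h(e)$); then $p'$ is subsonic for $(\eta_e,q_e)$. *Conclusion.* The steady-state mixture model 1–5 has at least one solution, and one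 that is subsonic in all pipes (every pressure between $p_{f(e)}$ and $p_{h(e)}$ is subsonic for $(\eta_e,q_e)$). -/

import Mathlib

open Set Filter Topology

noncomputable section

namespace GasMixture

/-! Gas mixture of two constituents in a pipe network with uniform pipe diameter; `η` is the
mass fraction of the first constituent, `q` the mass flux, `p` the pressure. -/

/-- Physical constants and the compressibility factor `Z η p` of the mixture. -/
structure MixtureGas where
  /-- universal gas constant -/
  R : ℝ
  /-- temperature -/
  T : ℝ
  /-- pipe diameter -/
  D : ℝ
  /-- friction coefficient -/
  friction : ℝ
  /-- molar mass of the first constituent -/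
  M₁ : ℝ
  /-- molar mass of the second constituent -/
  M₂ : ℝ
  /-- compressibility factor, as a function of mass fraction and pressure -/
  Z : ℝ → ℝ → ℝ
  R_pos : 0 < R
  T_pos : 0 < T
  D_pos : 0 < D
  friction_pos : 0 < friction
  M₁_pos : 0 < M₁
  M₂_pos : 0 < M₂

namespace MixtureGas

/-- Assumptions on the compressibility factor: it is continuous and positive, continuously
differentiable in the pressure, the density `p / Z` (up to a constant) is strictly increasing
in the pressure with positive derivative, and it vanishes as the pressure tends to zero. -/
structure AdmissibleCompressibility (G : MixtureGas) : Prop where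
  continuousOn : ContinuousOn (fun x : ℝ × ℝ => G.Z x.1 x.2) (Icc 0 1 ×ˢ Ioi 0)
  pos : ∀ η ∈ Icc (0 : ℝ) 1, ∀ p > 0, 0 < G.Z η p
  contDiffOn : ∀ η ∈ Icc (0 : ℝ) 1, ContDiffOn ℝ 1 (G.Z η) (Ioi 0)
  mul_deriv_lt : ∀ η ∈ Icc (0 : ℝ) 1, ∀ p > 0, p * deriv (G.Z η) p < G.Z η p
  vacuum : ∀ η ∈ Icc (0 : ℝ) 1, Tendsto (fun p => p / G.Z η p) (𝓝[>] 0) (𝓝 0)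

/-- Molar mass of the mixture with mass fraction `η` of the first constituent. -/
def molarMass (G : MixtureGas) (η : ℝ) : ℝ := 1 / (η / G.M₁ + (1 - η) / G.M₂)

/-- Density, from the real gas law `p = ρ (R T / M(η)) Z(η, p)`. -/
def density (G : MixtureGas) (η p : ℝ) : ℝ := p * G.molarMass η / (G.R * G.T * G.Z η p)

/-- Speed of sound `c = √(∂p/∂ρ)` at fixed composition. -/
def soundSpeed (G : MixtureGas) (η p : ℝ) : ℝ :=
  Real.sqrt (1 / deriv (fun s => G.density η s) p)

/-- The state `(η, q, p)` has positive pressure and its velocity `q / ρ` is smaller in modulus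
than the speed of sound. -/
def IsSubsonic (G : MixtureGas) (η q p : ℝ) : Prop :=
  0 < p ∧ |q / G.density η p| < G.soundSpeed η p

/-- The function `F` of the integrated stationary isothermal Euler equations
`d/dx (p + q² / ρ) = - friction / (2 D) * q |q| / ρ`; only differences of its values matter. -/
def F (G : MixtureGas) (η q p : ℝ) : ℝ :=
  (∫ s in (1 : ℝ)..p, s / G.Z η s)
    - q ^ 2 * (G.R * G.T / G.molarMass η) * Real.log (p / G.Z η p)

/-- Change of `F` over a distance `x`, measured in the direction of the edge. -/
def frictionTerm (G : MixtureGas) (η q x : ℝ) : ℝ :=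
  -(G.friction / (2 * G.D)) * (G.R * G.T / G.molarMass η) * x * (q * |q|)

/-- Pressure loss equation for a pipe of length `L` with pressure `pt` at its tail and `ph` at
its head. -/
def PressureLoss (G : MixtureGas) (L η q pt ph : ℝ) : Prop :=
  G.F η q ph - G.F η q pt = G.frictionTerm η q L

/-- The gas is subsonic everywhere in a pipe with end pressures `p₁`, `p₂`; the pressures in
the pipe are exactly the values between the end pressures. -/
def SubsonicBetween (G : MixtureGas) (η q p₁ p₂ : ℝ) : Prop :=
  ∀ s ∈ uIcc p₁ p₂, G.IsSubsonic η q s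

/-- The gas that starts with pressure `p` at the tail of a pipe of length `L` remains subsonic:
at every position `x` of the pipe which the pressure profile reaches through subsonic states, the
state is again subsonic. (Existence of a profile along the whole pipe is not demanded.) -/
def StaysSubsonicFromTail (G : MixtureGas) (L η q p : ℝ) : Prop :=
  ∀ x ∈ Icc 0 L, ∀ p' > 0, (∀ s, (p < s ∧ s < p' ∨ p' < s ∧ s < p) → G.IsSubsonic η q s) →
    G.F η q p' - G.F η q p = G.frictionTerm η q x → G.IsSubsonic η q p'

/-- The same for a pipe with known pressure `p` at its head, where `x` is the distance from the
head. -/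
def StaysSubsonicFromHead (G : MixtureGas) (L η q p : ℝ) : Prop :=
  ∀ x ∈ Icc 0 L, ∀ p' > 0, (∀ s, (p < s ∧ s < p' ∨ p' < s ∧ s < p) → G.IsSubsonic η q s) →
    G.F η q p - G.F η q p' = G.frictionTerm η q x → G.IsSubsonic η q p'

end MixtureGas

/-- A directed multigraph whose edges are compressors or pipes; pipes have a length. -/
structure GasNetwork (V E : Type*) where
  tail : E → V
  head : E → V
  compressors : Set E
  length : E → ℝ
  length_pos : ∀ e, e ∉ compressors → 0 < length e

/-- Data given for a network: load at the nodes (negative for supply), composition of the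
supply, compressor ratios, and one node with its pressure. -/
structure BoundaryData (V E : Type*) where
  load : V → ℝ
  supply : V → ℝ
  ratio : E → ℝ
  node : V
  pressure : ℝ

namespace GasNetwork

variable {V E : Type*}

/-- The underlying undirected graph is connected. -/
def IsConnected (N : GasNetwork V E) : Prop :=
  (SimpleGraph.fromRel fun u w => ∃ e, N.tail e = u ∧ N.head e = w).Connected

/-- `C` is the edge set of a cycle of the underlying undirected multigraph. Indices are cyclic.
(One edge from a node to itself, and two parallel edges, form a cycle.) -/
def IsCycle (N : GasNetwork V E) (C : Set E) : Prop :=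
  ∃ (n : ℕ) (v : Fin (n + 1) → V) (e : Fin (n + 1) → E),
    Function.Injective v ∧ Function.Injective e ∧ C = range e ∧
    ∀ i, (N.tail (e i) = v i ∧ N.head (e i) = v (i + 1)) ∨
      (N.head (e i) = v i ∧ N.tail (e i) = v (i + 1))

/-- Gas circulates: along some cycle all flows are nonzero and run in the same direction. -/
def Circulates (N : GasNetwork V E) (q : E → ℝ) : Prop :=
  ∃ (n : ℕ) (v : Fin (n + 1) → V) (e : Fin (n + 1) → E),
    Function.Injective v ∧ Function.Injective e ∧
    ∀ i, (N.tail (e i) = v i ∧ N.head (e i) = v (i + 1) ∧ 0 < q (e i)) ∨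
      (N.head (e i) = v i ∧ N.tail (e i) = v (i + 1) ∧ q (e i) < 0)

open Classical in
/-- Conservation of mass at the nodes, `A q = b` with the incidence matrix `A`. -/
def MassBalance [Fintype E] (N : GasNetwork V E) (b : V → ℝ) (q : E → ℝ) : Prop :=
  ∀ v, ∑ e, ((if N.head e = v then q e else 0) - (if N.tail e = v then q e else 0)) = b v

open Classical in
/-- Flow that enters the node `v` from the edge `e`. -/
def edgeInflow (N : GasNetwork V E) (q : E → ℝ) (v : V) (e : E) : ℝ :=
  (if N.head e = v then max (q e) 0 else 0) + (if N.tail e = v then max (-q e) 0 else 0)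

/-- Total flow that enters the node `v` from edges and from outside. -/
def totalInflow [Fintype E] (N : GasNetwork V E) (b : V → ℝ) (q : E → ℝ) (v : V) : ℝ :=
  ∑ e, N.edgeInflow q v e + max (-b v) 0

/-- An edge carries the composition of the node it is fed from. -/
def edgeComposition (N : GasNetwork V E) (q : E → ℝ) (η : V → ℝ) (e : E) : ℝ :=
  if 0 ≤ q e then η (N.tail e) else η (N.head e)

/-- Nodal mass fractions under perfect mixing. A node that no gas reaches (then its load is
zero) has its prescribed composition. -/
def IsComposition [Fintype E] (N : GasNetwork V E) (B : BoundaryData V E) (q : E → ℝ)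
    (η : V → ℝ) : Prop :=
  ∀ v, η v ∈ Icc (0 : ℝ) 1 ∧
    N.totalInflow B.load q v * η v
      = ∑ e, N.edgeInflow q v e * N.edgeComposition q η e + max (-B.load v) 0 * B.supply v ∧
    (N.totalInflow B.load q v = 0 → η v = B.supply v)

/-- The steady-state mixture model for flow `q`, nodal mass fraction `η`, nodal pressure `p`. -/
structure IsSteadyState [Fintype E] (G : MixtureGas) (N : GasNetwork V E)
    (B : BoundaryData V E) (q : E → ℝ) (η p : V → ℝ) : Prop where
  massBalance : N.MassBalance B.load q
  composition : N.IsComposition B q η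
  pressure_pos : ∀ v, 0 < p v
  pressure_node : p B.node = B.pressure
  compressor : ∀ e ∈ N.compressors, p (N.head e) = B.ratio e * p (N.tail e)
  pipe : ∀ e ∉ N.compressors, G.PressureLoss (N.length e) (N.edgeComposition q η e) (q e)
    (p (N.tail e)) (p (N.head e))

/-- The gas is subsonic in all pipes. -/
def IsSubsonicState (G : MixtureGas) (N : GasNetwork V E) (q : E → ℝ) (η p : V → ℝ) : Prop :=
  ∀ e ∉ N.compressors, G.SubsonicBetween (N.edgeComposition q η e) (q e)
    (p (N.tail e)) (p (N.head e))

/-- `PathPressure G N B q η W v π`: there is a path without repeated nodes from the node with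
given pressure to `v`, with set of nodes `W`, such that solving the compressor and the pressure
loss equations successively along it, in the subsonic regime, gives the pressure `π` at `v`. -/
inductive PathPressure (G : MixtureGas) (N : GasNetwork V E) (B : BoundaryData V E)
    (q : E → ℝ) (η : V → ℝ) : Set V → V → ℝ → Prop
  | start : PathPressure G N B q η {B.node} B.node B.pressure
  | compressorForward {W : Set V} {π : ℝ} (e : E) (he : e ∈ N.compressors)
      (hW : N.head e ∉ W) (h : PathPressure G N B q η W (N.tail e) π) :
      PathPressure G N B q η (insert (N.head e) W) (N.head e) (B.ratio e * π)
  | compressorBackward {W : Set V} {π : ℝ} (e : E) (he : e ∈ N.compressors)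
      (hW : N.tail e ∉ W) (h : PathPressure G N B q η W (N.head e) π) :
      PathPressure G N B q η (insert (N.tail e) W) (N.tail e) (π / B.ratio e)
  | pipeForward {W : Set V} {π π' : ℝ} (e : E) (he : e ∉ N.compressors)
      (hW : N.head e ∉ W) (h : PathPressure G N B q η W (N.tail e) π)
      (hloss : G.PressureLoss (N.length e) (N.edgeComposition q η e) (q e) π π')
      (hsub : G.SubsonicBetween (N.edgeComposition q η e) (q e) π π') :
      PathPressure G N B q η (insert (N.head e) W) (N.head e) π'
  | pipeBackward {W : Set V} {π π' : ℝ} (e : E) (he : e ∉ N.compressors)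
      (hW : N.tail e ∉ W) (h : PathPressure G N B q η W (N.head e) π)
      (hloss : G.PressureLoss (N.length e) (N.edgeComposition q η e) (q e) π' π)
      (hsub : G.SubsonicBetween (N.edgeComposition q η e) (q e) π' π) :
      PathPressure G N B q η (insert (N.tail e) W) (N.tail e) π'

/-- The gas flow is subsonic for the given data: for every balanced flow without circulation and
its composition, the gas does not reach a sonic state in a pipe when pressures are followed from
the node with given pressure along paths without repeated nodes. -/
def SubsonicFlow [Fintype E] (G : MixtureGas) (N : GasNetwork V E) (B : BoundaryData V E) :
    Prop :=
  ∀ (q : E → ℝ) (η : V → ℝ), N.MassBalance B.load q → ¬ N.Circulates q →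
    N.IsComposition B q η → ∀ (W : Set V) (v : V) (π : ℝ), PathPressure G N B q η W v π →
    ∀ e ∉ N.compressors,
      (N.tail e = v → N.head e ∉ W →
        G.StaysSubsonicFromTail (N.length e) (N.edgeComposition q η e) (q e) π) ∧
      (N.head e = v → N.tail e ∉ W →
        G.StaysSubsonicFromHead (N.length e) (N.edgeComposition q η e) (q e) π)

end GasNetwork

end GasMixture

end

/-! The cycle spans the kernel of the divergence, by `exists_eq_smul_of_divergence_eq_zero`, so the
balanced flows form a line `q₀ + t • c`. Let `[a, b]` be the interval from the first to the last
parameter at which the flow in some cycle edge vanishes. On it the flow does not circulate, at `b`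
every cycle flow agrees in direction with `c` or vanishes, and at `a` every one opposes `c` or
vanishes.

For flows without circulation, composition and pressures depend well on `t`. A maximum principle
(`composition_unique`) determines the composition wherever gas arrives. By `isSubsonic_iff` a state
is subsonic exactly when `F` has positive slope in the pressure. Hence the far-end pressure of a
pipe exists, because only a sonic state could stop the profile
(`exists_pressure_of_staysSubsonicFromTail`), and it varies continuously, even through zero flow
(`tendsto_pressure`).

Cut the network at its only edge outside a spanning tree rooted at the node with given pressure. The
tree yields continuous nodal pressures that satisfy all equations but one. Through the cut edge,
entered at one end, a second pressure for its other end is computed. Friction lowers the pressure in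
the flow direction, and the pressure differences around the cycle add up to zero, so the mismatch of
the two pressures has opposite signs at `a` and `b` (`mul_sub_nonneg`,
`EdgeRelation.mul_sub_nonpos`). It vanishes in between, and there the last equation holds as well.
-/

noncomputable section

namespace GasMixture

/-! ### The function `F` of the pressure in a single pipe. -/

namespace MixtureGas

/-- The factor `R T / M(η)`, the specific gas constant of the mixture times the temperature. -/
def specificConstant (G : MixtureGas) (η : ℝ) : ℝ := G.R * G.T / G.molarMass η

/-- The derivative of `F` with respect to the pressure. -/
def slope (G : MixtureGas) (η q p : ℝ) : ℝ :=
  p / G.Z η p - q ^ 2 * G.specificConstant η * ((G.Z η p - p * deriv (G.Z η) p) / (p * G.Z η p))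

variable {G : MixtureGas} {η q p : ℝ}

theorem specificConstant_eq (G : MixtureGas) (η : ℝ) :
    G.specificConstant η = G.R * G.T * (η / G.M₁ + (1 - η) / G.M₂) := by
  simp [specificConstant, molarMass]

theorem specificConstant_pos (hη : η ∈ Icc (0 : ℝ) 1) : 0 < G.specificConstant η := by
  rw [specificConstant_eq]
  have h1 := G.M₁_pos
  have h2 := G.M₂_pos
  refine mul_pos (mul_pos G.R_pos G.T_pos) ?_
  rcases eq_or_lt_of_le hη.1 with h | h
  · rw [← h]; simpa using h2
  · exact add_pos_of_pos_of_nonneg (div_pos h h1) (div_nonneg (by linarith [hη.2]) h2.le)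

theorem continuous_specificConstant (G : MixtureGas) : Continuous G.specificConstant := by
  rw [show G.specificConstant = _ from funext G.specificConstant_eq]
  fun_prop

namespace AdmissibleCompressibility

variable (hZ : G.AdmissibleCompressibility) (hη : η ∈ Icc (0 : ℝ) 1)

include hZ hη

theorem hasDerivAt (hp : 0 < p) : HasDerivAt (G.Z η) (deriv (G.Z η) p) p :=
  (((hZ.contDiffOn η hη).differentiableOn one_ne_zero).differentiableAt
    (Ioi_mem_nhds hp)).hasDerivAt

theorem continuousOn_deriv : ContinuousOn (deriv (G.Z η)) (Ioi 0) :=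
  (hZ.contDiffOn η hη).continuousOn_deriv_of_isOpen isOpen_Ioi le_rfl

theorem continuousOn_Z : ContinuousOn (G.Z η) (Ioi 0) :=
  (hZ.contDiffOn η hη).continuousOn

theorem continuousOn_div : ContinuousOn (fun s => s / G.Z η s) (Ioi 0) :=
  continuousOn_id.div (hZ.continuousOn_Z hη) fun s hs => (hZ.pos η hη s hs).ne'

theorem hasDerivAt_div (hp : 0 < p) :
    HasDerivAt (fun s => s / G.Z η s) ((G.Z η p - p * deriv (G.Z η) p) / G.Z η p ^ 2) p := by
  refine ((hasDerivAt_id p).div (hZ.hasDerivAt hη hp) (hZ.pos η hη p hp).ne').congr_deriv ?_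
  simp

theorem strictMonoOn_div : StrictMonoOn (fun s => s / G.Z η s) (Ioi 0) := by
  refine strictMonoOn_of_deriv_pos (convex_Ioi 0) (hZ.continuousOn_div hη) fun s hs => ?_
  rw [interior_Ioi] at hs
  rw [(hZ.hasDerivAt_div hη hs).deriv]
  exact div_pos (sub_pos.2 (hZ.mul_deriv_lt η hη s hs)) (pow_pos (hZ.pos η hη s hs) 2)

theorem intervalIntegrable {a b : ℝ} (ha : 0 < a) (hb : 0 < b) :
    IntervalIntegrable (fun s => s / G.Z η s) MeasureTheory.volume a b :=
  ((hZ.continuousOn_div hη).mono fun _ hs => (lt_min ha hb).trans_le hs.1).intervalIntegrable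

theorem hasDerivAt_integral (hp : 0 < p) :
    HasDerivAt (fun p => ∫ s in (1 : ℝ)..p, s / G.Z η s) (p / G.Z η p) p := by
  have hc := hZ.continuousOn_div hη
  exact intervalIntegral.integral_hasDerivAt_right (hZ.intervalIntegrable hη one_pos hp)
    (hc.stronglyMeasurableAtFilter isOpen_Ioi p hp) (hc.continuousAt (Ioi_mem_nhds hp))

theorem hasDerivAt_F (hp : 0 < p) : HasDerivAt (G.F η q) (G.slope η q p) p := by
  have h0 := hZ.pos η hη p hp
  have h := (hZ.hasDerivAt_integral hη hp).sub
    (((hZ.hasDerivAt_div hη hp).log (div_pos hp h0).ne').const_mul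
      (q ^ 2 * (G.R * G.T / G.molarMass η)))
  refine h.congr_deriv ?_
  unfold slope specificConstant
  field_simp

theorem continuousOn_F : ContinuousOn (G.F η q) (Ioi 0) := fun _ hp =>
  (hZ.hasDerivAt_F hη hp).continuousAt.continuousWithinAt

theorem continuousOn_slope : ContinuousOn (G.slope η q) (Ioi 0) := by
  have hz := hZ.continuousOn_Z hη
  have hd := hZ.continuousOn_deriv hη
  have h0 : ∀ s ∈ Ioi (0 : ℝ), G.Z η s ≠ 0 := fun s hs => (hZ.pos η hη s hs).ne'
  exact (hZ.continuousOn_div hη).sub (continuousOn_const.mul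
    ((hz.sub (continuousOn_id.mul hd)).div (continuousOn_id.mul hz)
      fun s hs => mul_ne_zero (ne_of_gt hs) (h0 s hs)))

/-- With `k` the specific constant and `w = Z - p ∂Z/∂p`, the squared velocity and the squared speed
of sound are the two terms of `slope` times the same positive factor `k Z³ / (p w)`. -/
theorem isSubsonic_iff : G.IsSubsonic η q p ↔ 0 < p ∧ 0 < G.slope η q p := by
  refine and_congr_right fun hp => ?_
  have h0 := hZ.pos η hη p hp
  have hk := specificConstant_pos (G := G) hη
  have hlt := sub_pos.2 (hZ.mul_deriv_lt η hη p hp)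
  set w := G.Z η p - p * deriv (G.Z η) p with hw
  have hden : ∀ s, G.density η s = (G.specificConstant η)⁻¹ * (s / G.Z η s) := by
    intro s
    simp only [density, specificConstant]
    rw [inv_div]
    ring
  have hderiv : deriv (fun s => G.density η s) p
      = (G.specificConstant η)⁻¹ * (w / G.Z η p ^ 2) := by
    rw [show (fun s => G.density η s) = _ from funext hden]
    exact ((hZ.hasDerivAt_div hη hp).const_mul _).deriv
  rw [soundSpeed, hderiv, Real.lt_sqrt (abs_nonneg _), sq_abs, hden, slope, ← hw, sub_pos]
  have e1 : (q / ((G.specificConstant η)⁻¹ * (p / G.Z η p))) ^ 2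
      = (q ^ 2 * G.specificConstant η * (w / (p * G.Z η p)))
        * (G.specificConstant η * G.Z η p ^ 3 / (p * w)) := by
    field_simp
  have e2 : 1 / ((G.specificConstant η)⁻¹ * (w / G.Z η p ^ 2))
      = (p / G.Z η p) * (G.specificConstant η * G.Z η p ^ 3 / (p * w)) := by
    field_simp
  rw [e1, e2]
  exact mul_lt_mul_iff_left₀ (by positivity)

theorem isSubsonic_zero (hp : 0 < p) : G.IsSubsonic η 0 p := by
  rw [hZ.isSubsonic_iff hη]
  refine ⟨hp, ?_⟩
  simpa [slope] using div_pos hp (hZ.pos η hη p hp)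

theorem strictMonoOn_F {S : Set ℝ} (hS : Convex ℝ S) (hpos : S ⊆ Ioi 0)
    (hsub : ∀ s ∈ interior S, G.IsSubsonic η q s) : StrictMonoOn (G.F η q) S := by
  refine strictMonoOn_of_deriv_pos hS ((hZ.continuousOn_F hη).mono hpos) fun s hs => ?_
  have h := (hZ.isSubsonic_iff hη).1 (hsub s hs)
  rw [(hZ.hasDerivAt_F hη h.1).deriv]
  exact h.2

/-- The density vanishes at zero pressure, so the logarithmic term blows up, while monotonicity of
`s / Z` keeps the integral bounded. Hence `F` cannot increase on all of `(0, p]`. -/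
theorem tendsto_F_zero (hq : q ≠ 0) : Tendsto (G.F η q) (𝓝[>] 0) atTop := by
  have hk := specificConstant_pos (G := G) hη
  have hu : Tendsto (fun p => p / G.Z η p) (𝓝[>] 0) (𝓝[>] 0) :=
    tendsto_nhdsWithin_of_tendsto_nhds_of_eventually_within _ (hZ.vacuum η hη)
      (eventually_nhdsWithin_of_forall fun s hs => div_pos hs (hZ.pos η hη s hs))
  have hc : 0 < q ^ 2 * G.specificConstant η := by positivity
  have h1 : Tendsto (fun p => -(1 / G.Z η 1) + q ^ 2 * G.specificConstant η *
      -Real.log (p / G.Z η p)) (𝓝[>] 0) atTop :=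
    tendsto_atTop_add_const_left _ _ ((tendsto_neg_atBot_atTop.comp
      (Real.tendsto_log_nhdsGT_zero.comp hu)).const_mul_atTop hc)
  refine tendsto_atTop_mono' _ ?_ h1
  have hmem : Ioo (0 : ℝ) 1 ∈ 𝓝[>] (0 : ℝ) := Ioo_mem_nhdsGT one_pos
  filter_upwards [hmem] with s hs
  have h2 : ∫ x in s..(1 : ℝ), x / G.Z η x ≤ ∫ x in s..(1 : ℝ), 1 / G.Z η 1 := by
    refine intervalIntegral.integral_mono_on hs.2.le (hZ.intervalIntegrable hη hs.1 one_pos)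
      (by simp) fun x hx => ?_
    exact (hZ.strictMonoOn_div hη).monotoneOn (hs.1.trans_le hx.1) (mem_Ioi.2 one_pos) hx.2
  rw [intervalIntegral.integral_const, smul_eq_mul] at h2
  have h3 : 0 < 1 / G.Z η 1 := div_pos one_pos (hZ.pos η hη 1 one_pos)
  rw [F, intervalIntegral.integral_symm]
  change _ ≤ -_ - q ^ 2 * G.specificConstant η * _
  nlinarith [hs.1, hs.2]

/-- A blow-up argument that needs no growth condition on `Z`. If `F ≤ b`, the integral `y` satisfies
`y' ≥ exp ((y - b) / c)`, so `exp (-(y - b) / c)` falls at rate at least `1 / c` and would become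
negative at a finite pressure. -/
theorem exists_lt_F (hq : q ≠ 0) (hp : 0 < p) (b : ℝ) : ∃ s, p ≤ s ∧ b < G.F η q s := by
  by_contra! hb
  have hk := specificConstant_pos (G := G) hη
  set c := q ^ 2 * G.specificConstant η with hcdef
  have hc : 0 < c := by positivity
  set y : ℝ → ℝ := fun p => ∫ s in (1 : ℝ)..p, s / G.Z η s with hy
  set h : ℝ → ℝ := fun s => Real.exp (-(y s - b) / c) with hh
  have hder : ∀ s, 0 < s → HasDerivAt h (h s * (-(s / G.Z η s) / c)) s := fun s hs =>
    ((((hZ.hasDerivAt_integral hη hs).sub_const b).neg.div_const c).exp)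
  have hle : ∀ s, p ≤ s → h s * (-(s / G.Z η s) / c) + 1 / c ≤ 0 := by
    intro s hs
    have hs0 := hp.trans_le hs
    have hu := div_pos hs0 (hZ.pos η hη s hs0)
    have h1 : y s - c * Real.log (s / G.Z η s) ≤ b := hb s hs
    have h2 : Real.exp ((y s - b) / c) ≤ s / G.Z η s := by
      rw [← Real.le_log_iff_exp_le hu, div_le_iff₀ hc]
      linarith
    have h3 : 1 ≤ h s * (s / G.Z η s) := by
      calc (1 : ℝ) = h s * Real.exp ((y s - b) / c) := by
            rw [hh, ← Real.exp_add, ← add_div, neg_add_cancel, zero_div, Real.exp_zero]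
        _ ≤ _ := mul_le_mul_of_nonneg_left h2 (Real.exp_pos _).le
    have : h s * (-(s / G.Z η s) / c) + 1 / c = (1 - h s * (s / G.Z η s)) / c := by ring
    rw [this]
    exact div_nonpos_of_nonpos_of_nonneg (by linarith) hc.le
  have hder' : ∀ s, 0 < s →
      HasDerivAt (fun s => h s + s / c) (h s * (-(s / G.Z η s) / c) + 1 / c) s := fun s hs =>
    (hder s hs).add ((hasDerivAt_id s).div_const c)
  have hanti : AntitoneOn (fun s => h s + s / c) (Ici p) := by
    refine antitoneOn_of_deriv_nonpos (convex_Ici p)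
      (fun s hs => (hder' s (hp.trans_le hs)).continuousAt.continuousWithinAt)
      (fun s hs => ?_) fun s hs => ?_
    · rw [interior_Ici] at hs
      exact (hder' s (hp.trans hs)).differentiableAt.differentiableWithinAt
    · rw [interior_Ici] at hs
      rw [(hder' s (hp.trans hs)).deriv]
      exact hle s (le_of_lt hs)
  have hpos : ∀ s, 0 < h s := fun s => Real.exp_pos _
  have hfin := hanti (self_mem_Ici (a := p)) (b := p + c * h p)
    (by simpa using (mul_pos hc (hpos p)).le) (by simpa using (mul_pos hc (hpos p)).le)
  have e : (p + c * h p) / c = p / c + h p := by field_simp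
  simp only [e] at hfin
  linarith [hpos (p + c * h p)]

end AdmissibleCompressibility

/-! ### Solving the pressure loss equation in a single pipe. -/

variable {p' L : ℝ}

/-- Reversing the edge changes the sign of `q`; friction is odd in `q`, while `F` and subsonicity
are even. Statements for the head thus reduce to statements for the tail. -/
theorem frictionTerm_neg (G : MixtureGas) (η q x : ℝ) :
    G.frictionTerm η (-q) x = -G.frictionTerm η q x := by
  simp only [frictionTerm, abs_neg]
  ring

theorem F_neg (G : MixtureGas) (η q p : ℝ) : G.F η (-q) p = G.F η q p := by
  simp only [F, neg_sq]

theorem isSubsonic_neg : G.IsSubsonic η (-q) p ↔ G.IsSubsonic η q p := by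
  simp only [IsSubsonic, neg_div, abs_neg]

theorem subsonicBetween_neg_comm :
    G.SubsonicBetween η (-q) p p' ↔ G.SubsonicBetween η q p' p := by
  simp only [SubsonicBetween, isSubsonic_neg, uIcc_comm]

theorem pressureLoss_neg_comm :
    G.PressureLoss L η (-q) p p' ↔ G.PressureLoss L η q p' p := by
  simp only [PressureLoss, F_neg, frictionTerm_neg]
  constructor <;> intro h <;> linarith

theorem staysSubsonicFromTail_neg :
    G.StaysSubsonicFromTail L η (-q) p ↔ G.StaysSubsonicFromHead L η q p := by
  simp only [StaysSubsonicFromTail, StaysSubsonicFromHead, F_neg, frictionTerm_neg, isSubsonic_neg]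
  refine forall₅_congr fun x _ p' _ _ => ?_
  rw [← neg_sub, neg_inj]

theorem frictionTerm_eq (G : MixtureGas) (η q x : ℝ) :
    G.frictionTerm η q x
      = -(G.friction / (2 * G.D) * G.specificConstant η * (q * |q|)) * x := by
  simp only [frictionTerm, specificConstant]
  ring

theorem frictionTerm_nonpos (hη : η ∈ Icc (0 : ℝ) 1) (hL : 0 ≤ L) (hq : 0 ≤ q) :
    G.frictionTerm η q L ≤ 0 := by
  have h1 := G.friction_pos
  have h2 := G.D_pos
  have h3 := specificConstant_pos (G := G) hη
  have : 0 ≤ G.friction / (2 * G.D) * G.specificConstant η * (q * |q|) * L := by positivity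
  rw [frictionTerm_eq]
  linarith

theorem exists_frictionTerm_eq {y : ℝ} (h : y ∈ uIcc 0 (G.frictionTerm η q L)) (hL : 0 ≤ L) :
    ∃ x ∈ Icc 0 L, G.frictionTerm η q x = y := by
  have hc : ContinuousOn (fun x => G.frictionTerm η q x) (uIcc 0 L) := by
    simp only [frictionTerm_eq]
    fun_prop
  have h0 : G.frictionTerm η q 0 = 0 := by simp [frictionTerm]
  rw [← h0] at h
  obtain ⟨x, hx, e⟩ := intermediate_value_uIcc hc h
  exact ⟨x, by rwa [uIcc_of_le hL] at hx, e⟩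

namespace AdmissibleCompressibility

variable (hZ : G.AdmissibleCompressibility) (hη : η ∈ Icc (0 : ℝ) 1)

include hZ hη

theorem strictMonoOn_F_of_subsonicBetween (h : G.SubsonicBetween η q p p') :
    StrictMonoOn (G.F η q) (uIcc p p') :=
  hZ.strictMonoOn_F hη (convex_uIcc p p') (fun s hs => (h s hs).1)
    fun s hs => h s (interior_subset hs)

/-- Subsonicity is an open condition because `slope` is continuous. Closedness provides a first
pressure at which the search for a solution stops. -/
theorem isClosed_exit {a b : ℝ} (ha : 0 < a) (S : Set ℝ) (hS : IsClosed S) :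
    IsClosed {s ∈ Icc a b | G.F η q s ∈ S ∨ ¬ G.IsSubsonic η q s} := by
  have hsub : Icc a b ⊆ Ioi 0 := fun s hs => ha.trans_le hs.1
  have h1 := ((hZ.continuousOn_F (q := q) hη).mono hsub).preimage_isClosed_of_isClosed
    isClosed_Icc hS
  have h2 := ((hZ.continuousOn_slope (q := q) hη).mono hsub).preimage_isClosed_of_isClosed
    isClosed_Icc (isClosed_Iic (a := (0 : ℝ)))
  convert h1.union h2 using 1
  ext s
  simp only [mem_ofPred_eq, mem_union, mem_inter_iff, mem_preimage, mem_Iic,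
    hZ.isSubsonic_iff hη, ← and_or_left]
  refine and_congr_right fun hs => or_congr_right ?_
  rw [not_and, not_lt]
  exact ⟨fun h => h (hsub hs), fun h _ => h⟩

/-- From the tail, the pressure loss equation is solved by the first pressure at which `F` attains
the required value or the gas is no longer subsonic; the latter is excluded by hypothesis. -/
theorem exists_pressure_of_staysSubsonicFromTail (hL : 0 ≤ L) (hp : 0 < p)
    (h : G.StaysSubsonicFromTail L η q p) :
    ∃ p', G.PressureLoss L η q p p' ∧ G.SubsonicBetween η q p p' := by
  have hstart : G.IsSubsonic η q p :=
    h 0 ⟨le_rfl, hL⟩ p hp (fun s hs => by rcases hs with hs | hs <;> linarith [hs.1, hs.2])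
      (by simp [frictionTerm])
  set δ := G.frictionTerm η q L with hδ
  rcases le_or_gt 0 q with hq | hq
  · have hδ0 : δ ≤ 0 := frictionTerm_nonpos hη hL hq
    -- The search goes down from `p`. Without an exit, `F` would increase on `(0, p]`, against its
    -- blow-up at zero.
    obtain ⟨s₀, hs₀, hs₀p, hs₀e⟩ : ∃ s, 0 < s ∧ s ≤ p ∧
        (G.F η q s ∈ Iic (G.F η q p + δ) ∨ ¬ G.IsSubsonic η q s) := by
      rcases hq.eq_or_lt with rfl | hq
      · exact ⟨p, hp, le_rfl, Or.inl (by simp [hδ, frictionTerm])⟩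
      by_contra! hcon
      have hmono : StrictMonoOn (G.F η q) (Ioc 0 p) :=
        hZ.strictMonoOn_F hη (convex_Ioc 0 p) (fun s hs => hs.1) fun s hs =>
          (hcon s (interior_subset hs).1 (interior_subset hs).2).2
      obtain ⟨s, hs, hs'⟩ := (((hZ.tendsto_F_zero hη hq.ne').eventually_gt_atTop
        (G.F η q p)).and (Ioc_mem_nhdsGT hp)).exists
      exact absurd (hmono.monotoneOn hs' ⟨hp, le_rfl⟩ hs'.2) (not_le.2 hs)
    obtain ⟨a, ha⟩ := (isCompact_Icc.of_isClosed_subset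
      (hZ.isClosed_exit (q := q) (b := p) hη hs₀ _ isClosed_Iic) (sep_subset _ _)).exists_isGreatest
      ⟨s₀, ⟨le_rfl, hs₀p⟩, hs₀e⟩
    obtain ⟨⟨haI, hae⟩, hmax⟩ := ha
    have ha0 : 0 < a := hs₀.trans_le haI.1
    have hgood : ∀ s, a < s → s ≤ p → G.F η q p + δ < G.F η q s ∧ G.IsSubsonic η q s := by
      intro s h1 h2
      by_contra hcon
      have : s ∈ {s ∈ Icc s₀ p | G.F η q s ∈ Iic (G.F η q p + δ) ∨ ¬ G.IsSubsonic η q s} := by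
        refine ⟨⟨haI.1.trans h1.le, h2⟩, ?_⟩
        rw [mem_Iic]
        by_contra! hcon'
        exact hcon hcon'
      exact absurd (hmax this) (not_le.2 h1)
    have hmono : StrictMonoOn (G.F η q) (Icc a p) :=
      hZ.strictMonoOn_F hη (convex_Icc a p) (fun s hs => ha0.trans_le hs.1) fun s hs => by
        rw [interior_Icc] at hs
        exact (hgood s hs.1 hs.2.le).2
    have hle : G.F η q a ≤ G.F η q p :=
      hmono.monotoneOn ⟨le_rfl, haI.2⟩ ⟨haI.2, le_rfl⟩ haI.2
    have hge : G.F η q p + δ ≤ G.F η q a := by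
      rcases haI.2.eq_or_lt with rfl | hlt
      · linarith
      have hc : ContinuousWithinAt (G.F η q) (Ioi a) a :=
        (hZ.hasDerivAt_F hη ha0).continuousAt.continuousWithinAt
      refine ge_of_tendsto hc ?_
      filter_upwards [Ioc_mem_nhdsGT hlt] with s hs
      exact (hgood s hs.1 hs.2).1.le
    -- The change of `F` up to the exit `a` lies between `δ` and `0`, so it is the friction over
    -- some distance `x ≤ L`. The hypothesis then makes `a` subsonic, and the exit must be due to
    -- the value of `F`.
    obtain ⟨x, hx, hxe⟩ := exists_frictionTerm_eq (G := G) (η := η) (q := q) (L := L)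
      (y := G.F η q a - G.F η q p)
      (by rw [uIcc_of_ge hδ0]; constructor <;> linarith) hL
    have hsa : G.IsSubsonic η q a := h x hx a ha0 (fun s hs => by
      rcases hs with hs | hs
      · linarith [hs.1, hs.2, haI.2]
      · exact (hgood s hs.1 hs.2.le).2) hxe.symm
    have heq : G.F η q a = G.F η q p + δ :=
      le_antisymm (hae.resolve_right (not_not.2 hsa)) hge
    refine ⟨a, by rw [PressureLoss, heq]; ring, fun s hs => ?_⟩
    rw [uIcc_of_ge haI.2] at hs
    rcases hs.1.eq_or_lt with rfl | hlt
    · exact hsa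
    · exact (hgood s hlt hs.2).2
  · have hδ0 : 0 ≤ δ := by
      have := frictionTerm_nonpos (G := G) hη hL (neg_nonneg.2 hq.le)
      rw [frictionTerm_neg] at this
      linarith
    -- For reversed flow the pressure rises towards the head, so the search goes upward and ends
    -- because `F` is unbounded.
    obtain ⟨s₀, hs₀p, hs₀e⟩ := hZ.exists_lt_F hη hq.ne hp (G.F η q p + δ)
    obtain ⟨a, ha⟩ := (isCompact_Icc.of_isClosed_subset
      (hZ.isClosed_exit (q := q) (b := s₀) hη hp (Ici (G.F η q p + δ)) isClosed_Ici)
      (sep_subset _ _)).exists_isLeast ⟨s₀, ⟨hs₀p, le_rfl⟩, Or.inl (mem_Ici.2 hs₀e.le)⟩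
    obtain ⟨⟨haI, hae⟩, hmin⟩ := ha
    have ha0 : 0 < a := hp.trans_le haI.1
    have hgood : ∀ s, p ≤ s → s < a → G.F η q s < G.F η q p + δ ∧ G.IsSubsonic η q s := by
      intro s h1 h2
      by_contra hcon
      have : s ∈ {s ∈ Icc p s₀ | G.F η q s ∈ Ici (G.F η q p + δ) ∨ ¬ G.IsSubsonic η q s} := by
        refine ⟨⟨h1, h2.le.trans haI.2⟩, ?_⟩
        rw [mem_Ici]
        by_contra! hcon'
        exact hcon hcon'
      exact absurd (hmin this) (not_le.2 h2)
    have hmono : StrictMonoOn (G.F η q) (Icc p a) :=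
      hZ.strictMonoOn_F hη (convex_Icc p a) (fun s hs => hp.trans_le hs.1) fun s hs => by
        rw [interior_Icc] at hs
        exact (hgood s hs.1.le hs.2).2
    have hle : G.F η q p ≤ G.F η q a :=
      hmono.monotoneOn ⟨le_rfl, haI.1⟩ ⟨haI.1, le_rfl⟩ haI.1
    have hge : G.F η q a ≤ G.F η q p + δ := by
      rcases haI.1.eq_or_lt with rfl | hlt
      · linarith
      have hc : ContinuousWithinAt (G.F η q) (Iio a) a :=
        (hZ.hasDerivAt_F hη ha0).continuousAt.continuousWithinAt
      refine le_of_tendsto hc ?_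
      filter_upwards [Ico_mem_nhdsLT hlt] with s hs
      exact (hgood s hs.1 hs.2).1.le
    obtain ⟨x, hx, hxe⟩ := exists_frictionTerm_eq (G := G) (η := η) (q := q) (L := L)
      (y := G.F η q a - G.F η q p)
      (by rw [uIcc_of_le hδ0]; constructor <;> linarith) hL
    have hsa : G.IsSubsonic η q a := h x hx a ha0 (fun s hs => by
      rcases hs with hs | hs
      · exact (hgood s hs.1.le hs.2).2
      · linarith [hs.1, hs.2, haI.1]) hxe.symm
    have heq : G.F η q a = G.F η q p + δ :=
      le_antisymm hge (hae.resolve_right (not_not.2 hsa))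
    refine ⟨a, by rw [PressureLoss, heq]; ring, fun s hs => ?_⟩
    rw [uIcc_of_le haI.1] at hs
    rcases hs.2.eq_or_lt with rfl | hlt
    · exact hsa
    · exact (hgood s hs.1 hlt).2

theorem exists_pressure_of_staysSubsonicFromHead (hL : 0 ≤ L) (hp : 0 < p)
    (h : G.StaysSubsonicFromHead L η q p) :
    ∃ p', G.PressureLoss L η q p' p ∧ G.SubsonicBetween η q p' p := by
  obtain ⟨p', h1, h2⟩ := hZ.exists_pressure_of_staysSubsonicFromTail hη hL hp
    (staysSubsonicFromTail_neg.2 h)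
  exact ⟨p', pressureLoss_neg_comm.1 h1, subsonicBetween_neg_comm.1 h2⟩

theorem head_le_tail (hL : 0 ≤ L) (hq : 0 ≤ q) (hloss : G.PressureLoss L η q p p')
    (hsub : G.SubsonicBetween η q p p') : p' ≤ p := by
  have := frictionTerm_nonpos (G := G) hη hL hq
  rw [← (hZ.strictMonoOn_F_of_subsonicBetween hη hsub).le_iff_le right_mem_uIcc left_mem_uIcc]
  rw [PressureLoss] at hloss
  linarith

theorem tail_le_head (hL : 0 ≤ L) (hq : q ≤ 0) (hloss : G.PressureLoss L η q p p')
    (hsub : G.SubsonicBetween η q p p') : p ≤ p' :=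
  hZ.head_le_tail hη hL (neg_nonneg.2 hq) (pressureLoss_neg_comm.2 hloss)
    (subsonicBetween_neg_comm.2 hsub)

theorem eq_of_pressureLoss_zero (hloss : G.PressureLoss L η 0 p p')
    (hsub : G.SubsonicBetween η 0 p p') : p' = p := by
  refine (hZ.strictMonoOn_F_of_subsonicBetween hη hsub).injOn right_mem_uIcc left_mem_uIcc ?_
  simpa [PressureLoss, frictionTerm, sub_eq_zero] using hloss

theorem pressureLoss_zero (L : ℝ) (hp : 0 < p) :
    G.PressureLoss L η 0 p p ∧ G.SubsonicBetween η 0 p p := by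
  refine ⟨by simp [PressureLoss, frictionTerm], fun s hs => ?_⟩
  rw [uIcc_self, mem_singleton_iff] at hs
  exact hZ.isSubsonic_zero hη (hs ▸ hp)

/-! ### Continuous dependence of the far-end pressure. -/

omit hη in
theorem tendsto_integral {ι : Type*} {l : Filter ι} {ηs ps : ι → ℝ}
    (hηs : ∀ᶠ i in l, ηs i ∈ Icc (0 : ℝ) 1) (hlη : Tendsto ηs l (𝓝 η))
    (hη : η ∈ Icc (0 : ℝ) 1) (hlp : Tendsto ps l (𝓝 p)) (hp : 0 < p) :
    Tendsto (fun i => ∫ s in (1 : ℝ)..ps i, s / G.Z (ηs i) s) l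
      (𝓝 (∫ s in (1 : ℝ)..p, s / G.Z η s)) := by
  -- Clamping by `r` makes the integrand continuous everywhere. Since `ε ≤ 1` and `ε < p`, it is
  -- unchanged on the intervals from `1` to pressures near `p`.
  set ε : ℝ := min (p / 2) 1 with hε
  have hε0 : 0 < ε := by positivity
  set r : ℝ × ℝ → ℝ × ℝ := fun x => (max 0 (min 1 x.1), max ε x.2) with hr
  have hrc : Continuous r := by fun_prop
  have hrm : ∀ x, r x ∈ Icc (0 : ℝ) 1 ×ˢ Ioi (0 : ℝ) := fun x =>
    ⟨⟨le_max_left _ _, max_le zero_le_one (min_le_left _ _)⟩, hε0.trans_le (le_max_left _ _)⟩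
  set g : ℝ → ℝ → ℝ := fun η s => (r (η, s)).2 / G.Z (r (η, s)).1 (r (η, s)).2 with hg
  have hgc : Continuous (Function.uncurry g) :=
    (continuous_snd.comp hrc).div (hZ.continuousOn.comp_continuous hrc hrm)
      fun x => (hZ.pos _ (hrm x).1 _ (hrm x).2).ne'
  have hI : Continuous fun x : ℝ × ℝ => ∫ s in (1 : ℝ)..x.2, g x.1 s := by
    refine intervalIntegral.continuous_parametric_intervalIntegral_of_continuous
      (f := fun (x : ℝ × ℝ) s => g x.1 s) ?_ continuous_snd
    exact hgc.comp (by fun_prop : Continuous fun y : (ℝ × ℝ) × ℝ => (y.1.1, y.2))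
  have heq : ∀ η' ∈ Icc (0 : ℝ) 1, ∀ p', ε < p' →
      ∫ s in (1 : ℝ)..p', g η' s = ∫ s in (1 : ℝ)..p', s / G.Z η' s := by
    intro η' hη' p' hp'
    refine intervalIntegral.integral_congr fun s hs => ?_
    have hs' : ε ≤ s := (le_min (min_le_right _ _) hp'.le).trans hs.1
    simp only [hg, hr, min_eq_right hη'.2, max_eq_right hη'.1, max_eq_right hs']
  have hεp : ε < p := (min_le_left _ _).trans_lt (by linarith)
  rw [← heq η hη p hεp]
  refine ((hI.tendsto (η, p)).comp (hlη.prodMk_nhds hlp)).congr' ?_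
  filter_upwards [hηs, hlp.eventually (lt_mem_nhds hεp)] with i h1 h2
  exact heq _ h1 _ h2

omit hη in
theorem tendsto_F {ι : Type*} {l : Filter ι} {ηs qs ps : ι → ℝ}
    (hηs : ∀ᶠ i in l, ηs i ∈ Icc (0 : ℝ) 1) (hlη : Tendsto ηs l (𝓝 η))
    (hη : η ∈ Icc (0 : ℝ) 1) (hlq : Tendsto qs l (𝓝 q)) (hlp : Tendsto ps l (𝓝 p))
    (hp : 0 < p) :
    Tendsto (fun i => G.F (ηs i) (qs i) (ps i)) l (𝓝 (G.F η q p)) := by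
  have hz : Tendsto (fun i => G.Z (ηs i) (ps i)) l (𝓝 (G.Z η p)) := by
    refine (hZ.continuousOn (η, p) ⟨hη, hp⟩).tendsto.comp
      (tendsto_nhdsWithin_iff.2 ⟨hlη.prodMk_nhds hlp, ?_⟩)
    filter_upwards [hηs, hlp.eventually (lt_mem_nhds hp)] with i h1 h2
    exact ⟨h1, h2⟩
  have h0 := hZ.pos η hη p hp
  exact (hZ.tendsto_integral hηs hlη hη hlp hp).sub
    (((hlq.pow 2).mul (((continuous_specificConstant G).tendsto η).comp hlη)).mul
      ((hlp.div hz h0.ne').log (div_pos hp h0).ne'))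

theorem exists_strictMonoOn_Icc (h : G.SubsonicBetween η q p p') :
    ∃ a b, 0 < a ∧ a < min p p' ∧ max p p' < b ∧ StrictMonoOn (G.F η q) (Icc a b) := by
  have hev : ∀ s, G.IsSubsonic η q s → ∀ᶠ x in 𝓝 s, G.IsSubsonic η q x := by
    intro s hs
    rw [hZ.isSubsonic_iff hη] at hs
    filter_upwards [lt_mem_nhds hs.1, ((hZ.continuousOn_slope hη).continuousAt
      (Ioi_mem_nhds hs.1)).eventually (lt_mem_nhds hs.2)] with x h1 h2
    exact (hZ.isSubsonic_iff hη).2 ⟨h1, h2⟩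
  obtain ⟨a, ha, ha'⟩ := mem_nhdsLE_iff_exists_Icc_subset.1
    (nhdsWithin_le_nhds (hev _ (h _ ⟨le_rfl, min_le_max⟩)))
  obtain ⟨b, hb, hb'⟩ := mem_nhdsGE_iff_exists_Icc_subset.1
    (nhdsWithin_le_nhds (hev _ (h _ ⟨min_le_max, le_rfl⟩)))
  have hall : ∀ s ∈ Icc a b, G.IsSubsonic η q s := by
    intro s hs
    rcases le_total s (min p p') with h1 | h1
    · exact ha' ⟨hs.1, h1⟩
    rcases le_total (max p p') s with h2 | h2
    · exact hb' ⟨h2, hs.2⟩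
    exact h s ⟨h1, h2⟩
  have hab : a ≤ b := (ha.le.trans min_le_max).trans hb.le
  exact ⟨a, b, (hall a ⟨le_rfl, hab⟩).1, ha, hb, hZ.strictMonoOn_F hη (convex_Icc a b)
    (fun s hs => (hall s hs).1) fun s hs => hall s (interior_subset hs)⟩

-- The equation forces `F` at `ps'` to converge to its value at `p'`. Strict monotonicity of the
-- limiting `F` slightly beyond the pipe's pressures traps `ps'` in a compact interval, where
-- injectivity identifies its limit.
omit hη in
theorem tendsto_pressure_of_tendsto_composition {ι : Type*} {U : Ultrafilter ι}
    {ηs qs ps ps' : ι → ℝ}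
    (hηs : ∀ᶠ i in U, ηs i ∈ Icc (0 : ℝ) 1) (hlη : Tendsto ηs U (𝓝 η))
    (hη : η ∈ Icc (0 : ℝ) 1) (hlq : Tendsto qs U (𝓝 q)) (hlp : Tendsto ps U (𝓝 p))
    (hlosss : ∀ᶠ i in U, G.PressureLoss L (ηs i) (qs i) (ps i) (ps' i))
    (hsubs : ∀ᶠ i in U, G.SubsonicBetween (ηs i) (qs i) (ps i) (ps' i))
    (hloss : G.PressureLoss L η q p p') (hsub : G.SubsonicBetween η q p p') :
    Tendsto ps' U (𝓝 p') := by
  obtain ⟨a, b, ha0, ha, hb, hmono⟩ := hZ.exists_strictMonoOn_Icc hη hsub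
  have hp : 0 < p := (hsub p left_mem_uIcc).1
  have hap := lt_min_iff.1 ha
  have hbp := max_lt_iff.1 hb
  have hfr : Tendsto (fun i => G.frictionTerm (ηs i) (qs i) L) U (𝓝 (G.frictionTerm η q L)) := by
    simp only [frictionTerm_eq]
    exact (((((continuous_specificConstant G).tendsto η).comp hlη).const_mul _).mul
      (hlq.mul hlq.abs)).neg.mul_const L
  have hF' : Tendsto (fun i => G.F (ηs i) (qs i) (ps' i)) U (𝓝 (G.F η q p')) := by
    have h1 := (hZ.tendsto_F hηs hlη hη hlq hlp hp).add hfr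
    rw [show G.frictionTerm η q L = _ from hloss.symm, add_sub_cancel] at h1
    refine h1.congr' ?_
    filter_upwards [hlosss] with i hi
    rw [show G.frictionTerm (ηs i) (qs i) L = _ from hi.symm, add_sub_cancel]
  have hmonos : ∀ᶠ i in U, StrictMonoOn (G.F (ηs i) (qs i)) (uIcc (ps i) (ps' i)) := by
    filter_upwards [hηs, hsubs] with i h1 h2
    exact hZ.strictMonoOn_F_of_subsonicBetween h1 h2
  -- Along an ultrafilter, failure means `ps' i < a` eventually. As `a` then lies between `ps' i`
  -- and `ps i`, monotonicity gives `F (ps' i) ≤ F a`, and in the limit `F p' ≤ F a`, which is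
  -- false.
  have hlow : ∀ᶠ i in U, a ≤ ps' i := by
    by_contra hcon
    have hcon : ∀ᶠ i in U, ¬ a ≤ ps' i := Ultrafilter.eventually_not.2 hcon
    have := le_of_tendsto_of_tendsto hF' (hZ.tendsto_F hηs hlη hη hlq tendsto_const_nhds ha0) (by
      filter_upwards [hcon, hmonos, hlp.eventually (lt_mem_nhds hap.1)] with i h1 h2 h3
      have h1 := (not_le.1 h1).le
      exact h2.monotoneOn right_mem_uIcc (mem_uIcc.2 (Or.inr ⟨h1, h3.le⟩)) h1)
    exact absurd this (not_le.2 (hmono ⟨le_rfl, (hap.1.trans hbp.1).le⟩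
      ⟨hap.2.le, hbp.2.le⟩ hap.2))
  have hupp : ∀ᶠ i in U, ps' i ≤ b := by
    by_contra hcon
    have hcon : ∀ᶠ i in U, ¬ ps' i ≤ b := Ultrafilter.eventually_not.2 hcon
    have := le_of_tendsto_of_tendsto (hZ.tendsto_F hηs hlη hη hlq tendsto_const_nhds
      (hp.trans hbp.1)) hF' (by
      filter_upwards [hcon, hmonos, hlp.eventually (gt_mem_nhds hbp.1)] with i h1 h2 h3
      have h1 := (not_le.1 h1).le
      exact h2.monotoneOn (mem_uIcc.2 (Or.inl ⟨h3.le, h1⟩)) right_mem_uIcc h1)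
    exact absurd this (not_le.2 (hmono ⟨hap.2.le, hbp.2.le⟩
      ⟨(hap.1.trans hbp.1).le, le_rfl⟩ hbp.2))
  obtain ⟨x, hx, hlx⟩ := (isCompact_Icc (a := a) (b := b)).ultrafilter_le_nhds' (U.map ps')
    (hlow.and hupp)
  have hlx : Tendsto ps' U (𝓝 x) := hlx
  have hFx := tendsto_nhds_unique hF'
    (hZ.tendsto_F hηs hlη hη hlq hlx (ha0.trans_le hx.1))
  rwa [hmono.injOn ⟨hap.2.le, hbp.2.le⟩ hx hFx]

omit hη in
/-- The pressure at the far end of a pipe depends continuously on the flow, the composition and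
the pressure at the near end. At vanishing flow, the composition is irrelevant. -/
theorem tendsto_pressure {ι : Type*} {U : Ultrafilter ι} {ηs qs ps ps' : ι → ℝ}
    (hηs : ∀ᶠ i in U, ηs i ∈ Icc (0 : ℝ) 1) (hlη : q ≠ 0 → Tendsto ηs U (𝓝 η))
    (hη : η ∈ Icc (0 : ℝ) 1) (hlq : Tendsto qs U (𝓝 q)) (hlp : Tendsto ps U (𝓝 p))
    (hlosss : ∀ᶠ i in U, G.PressureLoss L (ηs i) (qs i) (ps i) (ps' i))
    (hsubs : ∀ᶠ i in U, G.SubsonicBetween (ηs i) (qs i) (ps i) (ps' i))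
    (hloss : G.PressureLoss L η q p p') (hsub : G.SubsonicBetween η q p p') :
    Tendsto ps' U (𝓝 p') := by
  by_cases hq : q = 0
  · subst hq
    -- Here the compositions need not tend to `η`, but they have some limit `x` along the
    -- ultrafilter, and at zero flow the pressure is constant for every composition.
    obtain ⟨x, hx, hlx⟩ := (isCompact_Icc (a := (0 : ℝ)) (b := 1)).ultrafilter_le_nhds'
      (U.map ηs) hηs
    obtain rfl := hZ.eq_of_pressureLoss_zero hη hloss hsub
    have := hZ.pressureLoss_zero hx L (hsub p' left_mem_uIcc).1
    exact hZ.tendsto_pressure_of_tendsto_composition hηs hlx hx hlq hlp hlosss hsubs this.1 this.2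
  · exact hZ.tendsto_pressure_of_tendsto_composition hηs (hlη hq) hη hlq hlp hlosss hsubs hloss hsub

end AdmissibleCompressibility

end MixtureGas

/-! ### Flows, circulation and the kernel of the divergence. -/

namespace GasNetwork

variable {V E : Type*}

/-- The edge `e` joins `u` and `v`, and gas flows through it from `u` to `v`. -/
def Carries (N : GasNetwork V E) (q : E → ℝ) (e : E) (u v : V) : Prop :=
  (N.tail e = u ∧ N.head e = v ∧ 0 < q e) ∨ (N.head e = u ∧ N.tail e = v ∧ q e < 0)

theorem Carries.target_unique {N : GasNetwork V E} {q : E → ℝ} {e : E} {u v u' v' : V}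
    (h : N.Carries q e u v) (h' : N.Carries q e u' v') : v = v' := by
  rcases h with ⟨-, rfl, h⟩ | ⟨-, rfl, h⟩ <;> rcases h' with ⟨-, rfl, h'⟩ | ⟨-, rfl, h'⟩ <;>
    first | rfl | exact absurd h h'.not_gt

/-- If every node of a nonempty set is fed from a node of the set, then gas circulates. -/
theorem circulates_of_forall_exists_carries [Finite V] {N : GasNetwork V E} {q : E → ℝ}
    {S : Set V} (hne : S.Nonempty) (hS : ∀ v ∈ S, ∃ u ∈ S, ∃ e, N.Carries q e u v) :
    N.Circulates q := by
  obtain ⟨x, hx⟩ := hne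
  have : Nonempty E := let ⟨_, _, e, _⟩ := hS x hx; ⟨e⟩
  choose! g hgS ε hε using hS
  have hit : ∀ k, g^[k] x ∈ S := fun k => by
    induction k with
    | zero => exact hx
    | succ k ih => rw [Function.iterate_succ_apply']; exact hgS _ ih
  -- `g` moves one node upstream. An orbit in a finite set becomes periodic, and one minimal period
  -- visits distinct nodes.
  obtain ⟨i, j, hij, hxij⟩ := Finite.exists_ne_map_eq_of_infinite fun k => g^[k] x
  wlog hlt : i < j generalizing i j
  · exact this j i hij.symm hxij.symm (hij.lt_or_gt.resolve_left hlt)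
  set y := g^[i] x with hy
  have hper : Function.IsPeriodicPt g (j - i) y := by
    rw [Function.IsPeriodicPt, Function.IsFixedPt, hy, ← Function.iterate_add_apply,
      Nat.sub_add_cancel hlt.le]
    exact hxij.symm
  have hpos := hper.minimalPeriod_pos (Nat.sub_pos_of_lt hlt)
  obtain ⟨n, hn⟩ := Nat.exists_eq_succ_of_ne_zero hpos.ne'
  set w : Fin (n + 1) → V := fun k => g^[k] y with hw
  have hwS : ∀ k, w k ∈ S := fun k => by
    change g^[k] (g^[i] x) ∈ S
    rw [← Function.iterate_add_apply]
    exact hit _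
  have hwinj : Function.Injective w := fun a b hab => by
    refine Fin.ext (Function.iterate_injOn_Iio_minimalPeriod (f := g) (x := y) ?_ ?_ hab)
    · rw [hn]; exact a.2
    · rw [hn]; exact b.2
  have hstep : ∀ k, w (k + 1) = g (w k) := by
    intro k
    rcases Fin.eq_castSucc_or_eq_last k with ⟨k, rfl⟩ | rfl
    · simp only [hw, Fin.val_castSucc, ← Function.iterate_succ_apply', Fin.coeSucc_eq_succ,
        Fin.val_succ]
    · have : g^[n + 1] y = y := by
        have := Function.isPeriodicPt_minimalPeriod g y
        rwa [hn] at this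
      simp only [hw, Fin.last_add_one, Fin.val_zero, Fin.val_last, ← Function.iterate_succ_apply']
      exact this.symm
  -- The orbit runs against the flow; negated indices traverse it with the flow.
  have hcar : ∀ k : Fin (n + 1), N.Carries q (ε (w (-(k + 1)))) (w (-k)) (w (-(k + 1))) := by
    intro k
    have h := hε _ (hwS (-(k + 1)))
    rwa [← hstep, show -(k + 1) + 1 = -k by abel] at h
  refine ⟨n, fun k => w (-k), fun k => ε (w (-(k + 1))), fun a b hab => neg_injective (hwinj hab),
    fun a b hab => ?_, hcar⟩
  have ha := hcar a
  have hb := hcar b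
  simp only at hab
  rw [hab] at ha
  simpa using hwinj (ha.target_unique hb)

theorem edgeInflow_nonneg (N : GasNetwork V E) (q : E → ℝ) (v : V) (e : E) :
    0 ≤ N.edgeInflow q v e := by
  unfold edgeInflow
  positivity

theorem exists_carries_of_edgeInflow_pos {N : GasNetwork V E} {q : E → ℝ} {v : V} {e : E}
    (h : 0 < N.edgeInflow q v e) : ∃ u, N.Carries q e u v := by
  unfold edgeInflow at h
  rcases lt_trichotomy (q e) 0 with hq | hq | hq
  · refine ⟨N.head e, Or.inr ⟨rfl, ?_, hq⟩⟩
    by_contra hne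
    simp [hne, hq.le] at h
  · simp [hq] at h
  · refine ⟨N.tail e, Or.inl ⟨rfl, ?_, hq⟩⟩
    by_contra hne
    simp [hne, hq.le] at h

theorem Carries.edgeInflow_neg_pos {N : GasNetwork V E} {q : E → ℝ} {e : E} {u v : V}
    (h : N.Carries q e u v) : 0 < N.edgeInflow (-q) u e := by
  unfold edgeInflow
  rcases h with ⟨rfl, -, h⟩ | ⟨rfl, -, h⟩
  · refine add_pos_of_nonneg_of_pos (by positivity) ?_
    simpa using h
  · refine add_pos_of_pos_of_nonneg ?_ (by positivity)
    simpa using h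

open Classical in
/-- Inflow minus outflow at the nodes, as a linear function of the flow. -/
def divergence [Fintype E] (N : GasNetwork V E) : (E → ℝ) →ₗ[ℝ] (V → ℝ) where
  toFun q v := ∑ e, ((if N.head e = v then q e else 0) - (if N.tail e = v then q e else 0))
  map_add' q q' := by
    ext v
    rw [Pi.add_apply, ← Finset.sum_add_distrib]
    refine Finset.sum_congr rfl fun e _ => ?_
    rw [Pi.add_apply]
    split_ifs <;> ring
  map_smul' a q := by
    ext v
    rw [Pi.smul_apply, smul_eq_mul, RingHom.id_apply, Finset.mul_sum]
    refine Finset.sum_congr rfl fun e _ => ?_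
    rw [Pi.smul_apply, smul_eq_mul]
    split_ifs <;> ring

section Divergence

variable [Fintype E] {N : GasNetwork V E} {b : V → ℝ} {q : E → ℝ}

theorem massBalance_iff : N.MassBalance b q ↔ N.divergence q = b :=
  funext_iff.symm

open Classical in
theorem divergence_single (N : GasNetwork V E) (e : E) :
    N.divergence (Pi.single e 1) = Pi.single (N.head e) 1 - Pi.single (N.tail e) 1 := by
  ext v
  change ∑ x, _ = _
  rw [Finset.sum_eq_single e]
  · simp [Pi.single_apply, eq_comm]
  · intro x _ hx
    simp [hx]
  · simp

theorem sum_edgeInflow_sub (N : GasNetwork V E) (q : E → ℝ) (v : V) :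
    ∑ e, N.edgeInflow q v e - ∑ e, N.edgeInflow (-q) v e = N.divergence q v := by
  rw [← Finset.sum_sub_distrib]
  refine Finset.sum_congr rfl fun e _ => ?_
  unfold edgeInflow
  have := max_zero_sub_max_neg_zero_eq_self (q e)
  simp only [Pi.neg_apply, neg_neg]
  split_ifs <;> linarith

theorem totalInflow_eq (h : N.MassBalance b q) (v : V) :
    N.totalInflow b q v = ∑ e, N.edgeInflow (-q) v e + max (b v) 0 := by
  have h1 := sum_edgeInflow_sub N q v
  rw [massBalance_iff.1 h] at h1
  have h2 := max_zero_sub_max_neg_zero_eq_self (b v)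
  unfold totalInflow
  linarith

theorem totalInflow_nonneg (N : GasNetwork V E) (b : V → ℝ) (q : E → ℝ) (v : V) :
    0 ≤ N.totalInflow b q v :=
  add_nonneg (Finset.sum_nonneg fun e _ => edgeInflow_nonneg N q v e) (le_max_right _ _)

theorem Carries.totalInflow_pos (h : N.MassBalance b q) {e : E} {u v : V}
    (he : N.Carries q e u v) : 0 < N.totalInflow b q u := by
  rw [totalInflow_eq h]
  refine add_pos_of_pos_of_nonneg (he.edgeInflow_neg_pos.trans_le ?_) (le_max_right _ _)
  exact Finset.single_le_sum (fun e _ => edgeInflow_nonneg N (-q) u e) (Finset.mem_univ e)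

/-- A node that emits gas must also receive some, so the emitting nodes feed one another. -/
theorem circulates_of_divergence_eq_zero [Finite V] (h : N.divergence q = 0) (hq : q ≠ 0) :
    N.Circulates q := by
  have hstep : ∀ e u v, N.Carries q e u v → ∃ e' u', N.Carries q e' u' u := by
    intro e u v hc
    have h0 := hc.totalInflow_pos (massBalance_iff.2 h)
    simp only [totalInflow, Pi.zero_apply, neg_zero, max_self, add_zero] at h0
    obtain ⟨e', -, he'⟩ := Finset.exists_lt_of_sum_lt (f := fun _ => (0 : ℝ)) (by simpa using h0)
    exact ⟨e', exists_carries_of_edgeInflow_pos he'⟩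
  obtain ⟨e, he⟩ := Function.ne_iff.1 hq
  obtain ⟨u, v, huv⟩ : ∃ u v, N.Carries q e u v := by
    rcases lt_or_gt_of_ne he with he | he
    · exact ⟨_, _, Or.inr ⟨rfl, rfl, he⟩⟩
    · exact ⟨_, _, Or.inl ⟨rfl, rfl, he⟩⟩
  refine circulates_of_forall_exists_carries (S := {u | ∃ e v, N.Carries q e u v})
    ⟨u, e, v, huv⟩ ?_
  rintro u ⟨e, v, hc⟩
  obtain ⟨e', u', hc'⟩ := hstep e u v hc
  exact ⟨u', ⟨e', u, hc'⟩, e', hc'⟩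

/-- The signed sum of the cycle edges works: its divergence telescopes under the cyclic shift of the
indices. -/
theorem exists_divergence_eq_zero_of_cycle {n : ℕ} {v : Fin (n + 1) → V} {e : Fin (n + 1) → E}
    (he : Function.Injective e) (σ : Fin (n + 1) → ℝ)
    (h : ∀ i, (N.tail (e i) = v i ∧ N.head (e i) = v (i + 1) ∧ σ i = 1) ∨
      (N.head (e i) = v i ∧ N.tail (e i) = v (i + 1) ∧ σ i = -1)) :
    ∃ c : E → ℝ, N.divergence c = 0 ∧ (∀ i, c (e i) = σ i) ∧ ∀ x ∉ range e, c x = 0 := by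
  classical
  refine ⟨∑ i, σ i • Pi.single (e i) 1, ?_, fun i => ?_, fun x hx => ?_⟩
  · have : ∀ i, σ i • N.divergence (Pi.single (e i) 1)
        = Pi.single (v (i + 1)) 1 - Pi.single (v i) 1 := by
      intro i
      rw [divergence_single]
      rcases h i with ⟨h1, h2, h3⟩ | ⟨h1, h2, h3⟩
      · rw [h1, h2, h3, one_smul]
      · rw [h1, h2, h3, neg_one_smul, neg_sub]
    simp only [map_sum, map_smul, this, Finset.sum_sub_distrib]
    rw [sub_eq_zero]
    exact Equiv.sum_comp (Equiv.addRight (1 : Fin (n + 1)))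
      fun i => (Pi.single (v i) 1 : V → ℝ)
  · simp [Finset.sum_apply, Pi.single_apply, he.eq_iff]
  · rw [Finset.sum_apply]
    refine Finset.sum_eq_zero fun i _ => ?_
    have : x ≠ e i := fun h => hx ⟨i, h.symm⟩
    simp [this]

theorem IsCycle.exists_divergence_eq_zero {C : Set E} (hC : N.IsCycle C) :
    ∃ c : E → ℝ, N.divergence c = 0 ∧ (∀ e ∈ C, c e ≠ 0) ∧ ∀ e ∉ C, c e = 0 := by
  obtain ⟨n, v, e, -, he, rfl, h⟩ := hC
  have : ∀ i, ∃ σ : ℝ, σ ≠ 0 ∧ ((N.tail (e i) = v i ∧ N.head (e i) = v (i + 1) ∧ σ = 1) ∨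
      (N.head (e i) = v i ∧ N.tail (e i) = v (i + 1) ∧ σ = -1)) := by
    intro i
    rcases h i with h | h
    · exact ⟨1, one_ne_zero, Or.inl ⟨h.1, h.2, rfl⟩⟩
    · exact ⟨-1, by norm_num, Or.inr ⟨h.1, h.2, rfl⟩⟩
  choose σ hσ0 hσ using this
  obtain ⟨c, h1, h2, h3⟩ := exists_divergence_eq_zero_of_cycle he σ hσ
  refine ⟨c, h1, ?_, h3⟩
  rintro _ ⟨i, rfl⟩
  rw [h2]
  exact hσ0 i

omit [Fintype E] in
theorem IsCycle.nonempty {C : Set E} (hC : N.IsCycle C) : C.Nonempty := by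
  obtain ⟨n, v, e, -, -, rfl, -⟩ := hC
  exact range_nonempty e

theorem Circulates.exists_cycle (h : N.Circulates q) :
    ∃ C, N.IsCycle C ∧ ∃ c : E → ℝ, N.divergence c = 0 ∧ ∀ e ∈ C, 0 < c e * q e := by
  obtain ⟨n, v, e, hv, he, h⟩ := h
  have : ∀ i, ∃ σ : ℝ, 0 < σ * q (e i) ∧
      ((N.tail (e i) = v i ∧ N.head (e i) = v (i + 1) ∧ σ = 1) ∨
      (N.head (e i) = v i ∧ N.tail (e i) = v (i + 1) ∧ σ = -1)) := by
    intro i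
    rcases h i with h | h
    · exact ⟨1, by linarith [h.2.2], Or.inl ⟨h.1, h.2.1, rfl⟩⟩
    · exact ⟨-1, by linarith [h.2.2], Or.inr ⟨h.1, h.2.1, rfl⟩⟩
  choose σ hσ0 hσ using this
  obtain ⟨c, h1, h2, -⟩ := exists_divergence_eq_zero_of_cycle he σ hσ
  refine ⟨range e, ⟨n, v, e, hv, he, rfl, fun i => (h i).imp (fun h => ⟨h.1, h.2.1⟩)
    fun h => ⟨h.1, h.2.1⟩⟩, c, h1, ?_⟩
  rintro _ ⟨i, rfl⟩
  rw [h2]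
  exact hσ0 i

/-- In a network with one cycle, the flows without divergence form a line. -/
theorem exists_eq_smul_of_divergence_eq_zero [Finite V] {C : Set E} (hC : N.IsCycle C)
    (huniq : ∀ C', N.IsCycle C' → C' = C) {c d : E → ℝ} (hc : N.divergence c = 0)
    (hcC : ∀ e ∈ C, c e ≠ 0) (hd : N.divergence d = 0) : ∃ a : ℝ, d = a • c := by
  obtain ⟨e, he⟩ := hC.nonempty
  -- With this factor the difference vanishes at `e`. If it were nonzero, it would circulate along
  -- the only cycle, which contains `e`.
  refine ⟨d e / c e, ?_⟩
  by_contra hne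
  have hdiv : N.divergence (d - (d e / c e) • c) = 0 := by
    rw [map_sub, map_smul, hc, hd, smul_zero, sub_zero]
  obtain ⟨C', hC', c', -, hpos⟩ :=
    (circulates_of_divergence_eq_zero hdiv (sub_ne_zero.2 hne)).exists_cycle
  have := hpos e (by rwa [huniq C' hC'])
  simp [hcC e he] at this

/-- Circulation would have to run along `C`, in the direction of a multiple of `c`, so `c e * q e`
would have one strict sign throughout `C`. -/
theorem not_circulates [Finite V] {C : Set E} (hC : N.IsCycle C)
    (huniq : ∀ C', N.IsCycle C' → C' = C) {c : E → ℝ} (hc : N.divergence c = 0)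
    (hcC : ∀ e ∈ C, c e ≠ 0) (h₁ : ∃ e ∈ C, c e * q e ≤ 0) (h₂ : ∃ e ∈ C, 0 ≤ c e * q e) :
    ¬ N.Circulates q := by
  intro hcirc
  obtain ⟨C', hC', c', hc', hpos⟩ := hcirc.exists_cycle
  rw [huniq C' hC'] at hpos
  obtain ⟨a, rfl⟩ := exists_eq_smul_of_divergence_eq_zero hC huniq hc hcC hc'
  obtain ⟨e₁, he₁, h₁⟩ := h₁
  obtain ⟨e₂, he₂, h₂⟩ := h₂
  have p₁ := hpos e₁ he₁
  have p₂ := hpos e₂ he₂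
  simp only [Pi.smul_apply, smul_eq_mul, mul_assoc] at p₁ p₂
  have ha : a < 0 := by
    by_contra! ha
    exact absurd p₁ (not_lt.2 (mul_nonpos_of_nonneg_of_nonpos ha h₁))
  exact absurd p₂ (not_lt.2 (mul_nonpos_of_nonpos_of_nonneg ha.le h₂))

end Divergence

/-! ### Spanning trees and the edge outside the tree. -/

/-- A spanning tree with root `r`: every other node `v` is joined by the edge `par v` to a node
`up v` of smaller depth. -/
structure SpanningTree (N : GasNetwork V E) (r : V) where
  depth : V → ℕ
  up : V → V
  par : V → E
  depth_up : ∀ v, v ≠ r → depth (up v) < depth v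
  joins : ∀ v, v ≠ r → (N.tail (par v) = up v ∧ N.head (par v) = v) ∨
    (N.head (par v) = up v ∧ N.tail (par v) = v)

/-- The depth is the graph distance to `r`; the first step of a shortest walk gives the parent. -/
theorem IsConnected.nonempty_spanningTree [Nonempty E] {N : GasNetwork V E} (h : N.IsConnected) (r : V) :
    Nonempty (N.SpanningTree r) := by
  set Γ := SimpleGraph.fromRel fun u w => ∃ e, N.tail e = u ∧ N.head e = w with hΓ
  have hΓc : Γ.Connected := h
  have key : ∀ v, ∃ u e, v ≠ r → Γ.dist u r < Γ.dist v r ∧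
      ((N.tail e = u ∧ N.head e = v) ∨ (N.head e = u ∧ N.tail e = v)) := by
    intro v
    by_cases hv : v = r
    · exact ⟨v, Classical.arbitrary E, fun h => absurd hv h⟩
    obtain ⟨w, hw⟩ := hΓc.exists_walk_length_eq_dist v r
    cases w with
    | nil => exact absurd rfl hv
    | cons hadj w =>
      rename_i u
      have hlt : Γ.dist u r < Γ.dist v r := by
        rw [← hw, SimpleGraph.Walk.length_cons]
        exact Nat.lt_succ_of_le (SimpleGraph.dist_le w)
      rw [hΓ, SimpleGraph.fromRel_adj] at hadj
      rcases hadj.2 with ⟨e, he⟩ | ⟨e, he⟩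
      · exact ⟨u, e, fun _ => ⟨hlt, Or.inr ⟨he.2, he.1⟩⟩⟩
      · exact ⟨u, e, fun _ => ⟨hlt, Or.inl he⟩⟩
  choose u e hue using key
  exact ⟨⟨fun v => Γ.dist v r, u, e, fun v hv => (hue v hv).1, fun v hv => (hue v hv).2⟩⟩

namespace SpanningTree

variable {N : GasNetwork V E} {r : V} (T : N.SpanningTree r)

/-- The edges of the tree. -/
def edges : Set E := T.par '' {r}ᶜ

theorem induction {P : V → Prop} (root : P r) (step : ∀ v, v ≠ r → P (T.up v) → P v) (v : V) :
    P v := by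
  induction h : T.depth v using Nat.strong_induction_on generalizing v with
  | _ n ih =>
    by_cases hv : v = r
    · exact hv ▸ root
    · exact step v hv (ih _ (h ▸ T.depth_up v hv) _ rfl)

/-- Recursion along the tree. -/
theorem exists_recursion {α : Type*} (a : α) (f : V → α → α) :
    ∃ p : V → α, p r = a ∧ ∀ v, v ≠ r → p v = f v (p (T.up v)) := by
  classical
  let wf : WellFounded fun u v => T.depth u < T.depth v := InvImage.wf T.depth wellFounded_lt
  let p : V → α := wf.fix fun v rec => if hv : v = r then a else f v (rec _ (T.depth_up v hv))
  refine ⟨p, ?_, fun v hv => ?_⟩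
  · simp only [p]
    rw [wf.fix_eq, dif_pos rfl]
  · simp only [p]
    rw [wf.fix_eq, dif_neg hv]

variable [Fintype E]

open Classical in
theorem exists_divergence_eq_single_sub (v : V) :
    ∃ q : E → ℝ, N.divergence q = Pi.single v 1 - Pi.single r 1 ∧ ∀ e ∉ T.edges, q e = 0 := by
  refine T.induction
    (P := fun v => ∃ q : E → ℝ, N.divergence q = Pi.single v 1 - Pi.single r 1 ∧
      ∀ e ∉ T.edges, q e = 0) ⟨0, by simp, fun _ _ => rfl⟩ (fun v hv ⟨q, h1, h2⟩ => ?_) v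
  have hne : ∀ e ∉ T.edges, e ≠ T.par v := fun e he h => he ⟨v, hv, h.symm⟩
  rcases T.joins v hv with ⟨ht, hh⟩ | ⟨hh, ht⟩
  · refine ⟨q + Pi.single (T.par v) 1, ?_, fun e he => by simp [h2 e he, hne e he]⟩
    rw [map_add, h1, divergence_single, ht, hh]
    abel
  · refine ⟨q - Pi.single (T.par v) 1, ?_, fun e he => by simp [h2 e he, hne e he]⟩
    rw [map_sub, h1, divergence_single, ht, hh]
    abel

theorem exists_massBalance [Fintype V] (T : N.SpanningTree r) {b : V → ℝ} (hb : ∑ v, b v = 0) :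
    ∃ q, N.MassBalance b q := by
  classical
  choose q hq _ using T.exists_divergence_eq_single_sub
  refine ⟨∑ v, b v • q v, massBalance_iff.2 ?_⟩
  simp only [map_sum, map_smul, hq, smul_sub, Finset.sum_sub_distrib, ← Finset.sum_smul, hb,
    zero_smul, sub_zero]
  ext w
  simp [Finset.sum_apply, Pi.single_apply]

/-- The edge `e` is closed up by tree flows from its head back to the root and on to its tail. -/
theorem exists_fundamental {e : E} (he : e ∉ T.edges) :
    ∃ d : E → ℝ, N.divergence d = 0 ∧ d e = 1 ∧ ∀ e' ∉ T.edges, e' ≠ e → d e' = 0 := by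
  classical
  obtain ⟨q₁, h1, h1'⟩ := T.exists_divergence_eq_single_sub (N.head e)
  obtain ⟨q₂, h2, h2'⟩ := T.exists_divergence_eq_single_sub (N.tail e)
  refine ⟨Pi.single e 1 - q₁ + q₂, ?_, by simp [h1' e he, h2' e he],
    fun e' he' hne => by simp [h1' e' he', h2' e' he', hne]⟩
  rw [map_add, map_sub, h1, h2, divergence_single]
  abel

variable [Finite V] {C : Set E} (hC : N.IsCycle C) (huniq : ∀ C', N.IsCycle C' → C' = C)
  {c : E → ℝ} (hc : N.divergence c = 0) (hcC : ∀ e ∈ C, c e ≠ 0)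

include hC huniq hc hcC

theorem ne_zero_of_not_mem_edges {e : E} (he : e ∉ T.edges) : c e ≠ 0 := by
  obtain ⟨d, hd, hd1, -⟩ := T.exists_fundamental he
  obtain ⟨a, rfl⟩ := exists_eq_smul_of_divergence_eq_zero hC huniq hc hcC hd
  rintro h
  simp [h] at hd1

/-- The fundamental flow of `e` would vanish at `e'`, yet it is a nonzero multiple of `c`, which
does not vanish there. -/
theorem eq_of_not_mem_edges {e e' : E} (he : e ∉ T.edges) (he' : e' ∉ T.edges) : e = e' := by
  by_contra hne
  obtain ⟨d, hd, hd1, hd0⟩ := T.exists_fundamental he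
  obtain ⟨a, rfl⟩ := exists_eq_smul_of_divergence_eq_zero hC huniq hc hcC hd
  have h := hd0 e' he' (Ne.symm hne)
  have h' := T.ne_zero_of_not_mem_edges hC huniq hc hcC he'
  simp only [Pi.smul_apply, smul_eq_mul, mul_eq_zero, h', or_false] at h
  simp [h] at hd1

end SpanningTree

end GasNetwork

/-! ### Existence, uniqueness and continuity of the composition. -/

namespace GasNetwork

variable {V E : Type*} [Fintype E] {N : GasNetwork V E} {B : BoundaryData V E} {q : E → ℝ}
  {η η' : V → ℝ}

omit [Fintype E] in
theorem Carries.edgeComposition_eq {e : E} {u v : V} (h : N.Carries q e u v) (η : V → ℝ) :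
    N.edgeComposition q η e = η u := by
  unfold edgeComposition
  rcases h with ⟨rfl, -, h⟩ | ⟨rfl, -, h⟩
  · rw [if_pos h.le]
  · rw [if_neg (not_le.2 h)]

omit [Fintype E] in
theorem edgeComposition_mem (h : ∀ v, η v ∈ Icc (0 : ℝ) 1) (e : E) :
    N.edgeComposition q η e ∈ Icc (0 : ℝ) 1 := by
  unfold edgeComposition
  split_ifs
  · exact h _
  · exact h _

-- The edge composition jumps where the flow changes sign, but its product with the inflow is
-- continuous in `q` and `η`.
open Classical in
omit [Fintype E] in
theorem edgeInflow_mul_edgeComposition (N : GasNetwork V E) (q : E → ℝ) (η : V → ℝ) (v : V)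
    (e : E) : N.edgeInflow q v e * N.edgeComposition q η e
      = (if N.head e = v then max (q e) 0 * η (N.tail e) else 0)
        + (if N.tail e = v then max (-q e) 0 * η (N.head e) else 0) := by
  unfold edgeInflow edgeComposition
  rcases le_or_gt 0 (q e) with h | h
  · simp [h]
  · simp [h.le, not_le.2 h]

theorem load_nonpos_of_totalInflow_eq_zero (h : N.MassBalance B.load q) {v : V}
    (h0 : N.totalInflow B.load q v = 0) : B.load v ≤ 0 := by
  rw [totalInflow_eq h] at h0
  have h1 := Finset.sum_nonneg fun e (_ : e ∈ Finset.univ) => edgeInflow_nonneg N (-q) v e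
  linarith [le_max_left (B.load v) 0, le_max_right (B.load v) 0]

/-- Nodal compositions exist for every balanced flow, as a fixed point of the monotone map that
mixes the gas at each node. -/
theorem exists_isComposition (hsupply : ∀ v, B.load v ≤ 0 → B.supply v ∈ Icc (0 : ℝ) 1)
    (h : N.MassBalance B.load q) : ∃ η, N.IsComposition B q η := by
  -- This makes the unit interval a complete lattice, so that the least fixed point is available.
  have : Fact ((0 : ℝ) ≤ 1) := ⟨zero_le_one⟩
  set num : (V → Icc (0 : ℝ) 1) → V → ℝ := fun x v =>
    ∑ e, N.edgeInflow q v e * N.edgeComposition q (fun u => x u) e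
      + max (-B.load v) 0 * B.supply v with hnum
  have hsup : ∀ v, max (-B.load v) 0 * B.supply v ∈ Icc 0 (max (-B.load v) 0) := by
    intro v
    rcases le_or_gt (B.load v) 0 with hv | hv
    · have := hsupply v hv
      exact ⟨mul_nonneg (le_max_right _ _) this.1,
        mul_le_of_le_one_right (le_max_right _ _) this.2⟩
    · simp [hv.le]
  have hcomp : ∀ (x : V → Icc (0 : ℝ) 1) e,
      N.edgeComposition q (fun u => x u) e ∈ Icc (0 : ℝ) 1 :=
    fun x e => edgeComposition_mem (fun v => (x v).2) e
  have hmem : ∀ x v, num x v ∈ Icc 0 (N.totalInflow B.load q v) := fun x v =>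
    ⟨add_nonneg (Finset.sum_nonneg fun e _ => mul_nonneg (edgeInflow_nonneg N q v e)
      (hcomp x e).1) (hsup v).1, add_le_add (Finset.sum_le_sum fun e _ =>
      mul_le_of_le_one_right (edgeInflow_nonneg N q v e) (hcomp x e).2) (hsup v).2⟩
  have hmono : ∀ x y, x ≤ y → ∀ v, num x v ≤ num y v := by
    intro x y hxy v
    refine add_le_add_left (Finset.sum_le_sum fun e _ =>
      mul_le_mul_of_nonneg_left ?_ (edgeInflow_nonneg N q v e)) _
    unfold edgeComposition
    split_ifs
    · exact hxy _
    · exact hxy _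
  classical
  let Φ : (V → Icc (0 : ℝ) 1) →o (V → Icc (0 : ℝ) 1) :=
    { toFun := fun x v => if h0 : N.totalInflow B.load q v = 0
        then ⟨B.supply v, hsupply v (load_nonpos_of_totalInflow_eq_zero h h0)⟩
        else ⟨num x v / N.totalInflow B.load q v,
          div_nonneg (hmem x v).1 (totalInflow_nonneg N _ q v),
          div_le_one_of_le₀ (hmem x v).2 (totalInflow_nonneg N _ q v)⟩
      monotone' := fun x y hxy v => by
        dsimp only
        split_ifs
        · exact le_rfl
        · exact Subtype.mk_le_mk.2
            (div_le_div_of_nonneg_right (hmono x y hxy v) (totalInflow_nonneg N _ q v)) }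
  obtain ⟨x, hx⟩ : ∃ x, Φ x = x := ⟨_, Φ.map_lfp⟩
  have hval : ∀ v, (x v : ℝ) = (Φ x v : ℝ) := fun v => by rw [hx]
  refine ⟨fun v => x v, fun v => ⟨(x v).2, ?_, fun h0 => ?_⟩⟩
  · change _ = num x v
    by_cases h0 : N.totalInflow B.load q v = 0
    · have := hmem x v
      rw [h0] at this ⊢
      linarith [this.1, this.2]
    · change _ * (x v : ℝ) = _
      rw [hval]
      rw [show (Φ x v : ℝ) = num x v / N.totalInflow B.load q v from
        congrArg Subtype.val (dif_neg h0)]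
      field_simp
  · change (x v : ℝ) = _
    rw [hval]
    exact congrArg Subtype.val (dif_pos h0)

/-- Without circulation, the mixing equations determine the composition of all nodes which are
reached by gas. -/
theorem composition_unique [Finite V] (h : N.MassBalance B.load q) (hq : ¬ N.Circulates q)
    (hη : ∀ v, N.totalInflow B.load q v * η v
      = ∑ e, N.edgeInflow q v e * N.edgeComposition q η e + max (-B.load v) 0 * B.supply v)
    (hη' : ∀ v, N.totalInflow B.load q v * η' v
      = ∑ e, N.edgeInflow q v e * N.edgeComposition q η' e + max (-B.load v) 0 * B.supply v)
    {v : V} (hv : 0 < N.totalInflow B.load q v) : η v = η' v := by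
  by_contra hne
  obtain ⟨w, hw, hmax⟩ := Set.exists_max_image {v | 0 < N.totalInflow B.load q v}
    (fun v => |η v - η' v|) (Set.toFinite _) ⟨v, hv⟩
  set m := |η w - η' w| with hm
  have hm0 : 0 < m := (abs_pos.2 (sub_ne_zero.2 hne)).trans_le (hmax v hv)
  refine hq (circulates_of_forall_exists_carries
    (S := {v | 0 < N.totalInflow B.load q v ∧ |η v - η' v| = m}) ⟨w, hw, rfl⟩ ?_)
  rintro v ⟨hv, hvm⟩
  set δ : E → ℝ := fun e => N.edgeComposition q η e - N.edgeComposition q η' e with hδ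
  have hle : N.totalInflow B.load q v * m ≤ ∑ e, N.edgeInflow q v e * |δ e| := by
    have h1 : N.totalInflow B.load q v * (η v - η' v) = ∑ e, N.edgeInflow q v e * δ e := by
      simp only [hδ, mul_sub, Finset.sum_sub_distrib]
      linarith [hη v, hη' v]
    calc N.totalInflow B.load q v * m = |∑ e, N.edgeInflow q v e * δ e| := by
          rw [← h1, abs_mul, hvm, abs_of_pos hv]
      _ ≤ ∑ e, |N.edgeInflow q v e * δ e| := Finset.abs_sum_le_sum_abs _ _
      _ = _ := Finset.sum_congr rfl fun e _ => by
          rw [abs_mul, abs_of_nonneg (edgeInflow_nonneg N q v e)]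
  -- Maximum principle: the mixing average attains the maximal deviation `m`, so some inflow carries
  -- at least `m`, and its source is again a maximizer. The maximizers thus feed one another, which
  -- forces circulation.
  have hex : ∃ e, 0 < N.edgeInflow q v e ∧ m ≤ |δ e| := by
    by_contra! hcon
    have hsum : ∑ e, N.edgeInflow q v e * m ≤ N.totalInflow B.load q v * m := by
      rw [← Finset.sum_mul]
      exact mul_le_mul_of_nonneg_right (le_add_of_nonneg_right (le_max_right _ _)) hm0.le
    have hterm : ∀ e ∈ Finset.univ, N.edgeInflow q v e * |δ e| ≤ N.edgeInflow q v e * m := by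
      intro e _
      rcases (edgeInflow_nonneg N q v e).eq_or_lt with h0 | h0
      · simp [← h0]
      · exact mul_le_mul_of_nonneg_left (hcon e h0).le h0.le
    by_cases hpos : ∃ e, 0 < N.edgeInflow q v e
    · obtain ⟨e, he⟩ := hpos
      have := Finset.sum_lt_sum hterm
        ⟨e, Finset.mem_univ e, mul_lt_mul_of_pos_left (hcon e he) he⟩
      linarith
    · have h0 : ∀ e, N.edgeInflow q v e = 0 := fun e =>
        le_antisymm (not_lt.1 fun he => hpos ⟨e, he⟩) (edgeInflow_nonneg N q v e)
      simp only [h0, zero_mul, Finset.sum_const_zero] at hle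
      exact absurd hle (not_le.2 (mul_pos hv hm0))
  obtain ⟨e, he, hme⟩ := hex
  obtain ⟨u, hu⟩ := exists_carries_of_edgeInflow_pos he
  have hupos := hu.totalInflow_pos h
  simp only [hδ, hu.edgeComposition_eq] at hme
  exact ⟨u, ⟨hupos, le_antisymm (hmax u hupos) hme⟩, e, hu⟩

section Limit

variable {ι : Type*} {U : Ultrafilter ι} {qs : ι → E → ℝ} {ηs : ι → V → ℝ}

/-- By compactness the compositions converge along the ultrafilter. The limit satisfies the mixing
equations, though perhaps not the convention at unreached nodes, and uniqueness needs only the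
former. -/
theorem tendsto_composition [Finite V] (h : N.MassBalance B.load q) (hq : ¬ N.Circulates q)
    (hη : N.IsComposition B q η) (hqs : ∀ e, Tendsto (fun i => qs i e) U (𝓝 (q e)))
    (hηs : ∀ᶠ i in U, N.IsComposition B (qs i) (ηs i))
    {v : V} (hv : 0 < N.totalInflow B.load q v) : Tendsto (fun i => ηs i v) U (𝓝 (η v)) := by
  have hlim : ∀ v, ∃ y, Tendsto (fun i => ηs i v) U (𝓝 y) := by
    intro v
    obtain ⟨y, -, hy⟩ := (isCompact_Icc (a := (0 : ℝ)) (b := 1)).ultrafilter_le_nhds'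
      (U.map fun i => ηs i v) (hηs.mono fun i hi => (hi v).1)
    exact ⟨y, hy⟩
  choose y hy using hlim
  have hmix : ∀ v, N.totalInflow B.load q v * y v
      = ∑ e, N.edgeInflow q v e * N.edgeComposition q y e
        + max (-B.load v) 0 * B.supply v := by
    intro v
    have hL : Tendsto (fun i => N.totalInflow B.load (qs i) v * ηs i v) U
        (𝓝 (N.totalInflow B.load q v * y v)) := by
      refine Tendsto.mul (Tendsto.add_const _ (tendsto_finsetSum _ fun e _ => ?_)) (hy v)
      unfold edgeInflow
      refine Tendsto.add ?_ ?_
      · split_ifs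
        · exact (hqs e).max tendsto_const_nhds
        · exact tendsto_const_nhds
      · split_ifs
        · exact (hqs e).neg.max tendsto_const_nhds
        · exact tendsto_const_nhds
    refine tendsto_nhds_unique (hL.congr' (hηs.mono fun i hi => (hi v).2.1)) ?_
    refine Tendsto.add_const _ (tendsto_finsetSum _ fun e _ => ?_)
    simp only [edgeInflow_mul_edgeComposition]
    refine Tendsto.add ?_ ?_
    · split_ifs
      · exact ((hqs e).max tendsto_const_nhds).mul (hy _)
      · exact tendsto_const_nhds
    · split_ifs
      · exact ((hqs e).neg.max tendsto_const_nhds).mul (hy _)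
      · exact tendsto_const_nhds
  rw [composition_unique h hq (fun v => (hη v).2.1) hmix hv]
  exact hy v

theorem tendsto_edgeComposition [Finite V] (h : N.MassBalance B.load q) (hq : ¬ N.Circulates q)
    (hη : N.IsComposition B q η) (hqs : ∀ e, Tendsto (fun i => qs i e) U (𝓝 (q e)))
    (hηs : ∀ᶠ i in U, N.IsComposition B (qs i) (ηs i)) {e : E} (he : q e ≠ 0) :
    Tendsto (fun i => N.edgeComposition (qs i) (ηs i) e) U (𝓝 (N.edgeComposition q η e)) := by
  rcases lt_or_gt_of_ne he with he | he
  · have hc : N.Carries q e (N.head e) (N.tail e) := Or.inr ⟨rfl, rfl, he⟩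
    rw [hc.edgeComposition_eq]
    refine (tendsto_composition h hq hη hqs hηs (hc.totalInflow_pos h)).congr' ?_
    filter_upwards [(hqs e).eventually (gt_mem_nhds he)] with i hi
    rw [edgeComposition, if_neg (not_le.2 hi)]
  · have hc : N.Carries q e (N.tail e) (N.head e) := Or.inl ⟨rfl, rfl, he⟩
    rw [hc.edgeComposition_eq]
    refine (tendsto_composition h hq hη hqs hηs (hc.totalInflow_pos h)).congr' ?_
    filter_upwards [(hqs e).eventually (lt_mem_nhds he)] with i hi
    rw [edgeComposition, if_pos hi.le]

end Limit

end GasNetwork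

/-! ### Pressures along the spanning tree. -/

namespace GasNetwork

variable {V E : Type*}

/-- The equation of the edge `e` between the pressures `pt` at its tail and `ph` at its head; pipes
are required to be subsonic. -/
def EdgeRelation (G : MixtureGas) (N : GasNetwork V E) (B : BoundaryData V E) (q : E → ℝ)
    (η : V → ℝ) (e : E) (pt ph : ℝ) : Prop :=
  (e ∈ N.compressors → ph = B.ratio e * pt) ∧
  (e ∉ N.compressors →
    G.PressureLoss (N.length e) (N.edgeComposition q η e) (q e) pt ph ∧
    G.SubsonicBetween (N.edgeComposition q η e) (q e) pt ph)

variable {G : MixtureGas} {N : GasNetwork V E} {B : BoundaryData V E} {q : E → ℝ} {η : V → ℝ}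
  {W : Set V} {v : V} {e : E} {π π' : ℝ}

theorem PathPressure.pos (hratio : ∀ e ∈ N.compressors, 1 ≤ B.ratio e) (hpressure : 0 < B.pressure)
    (h : PathPressure G N B q η W v π) : 0 < π := by
  induction h with
  | start => exact hpressure
  | compressorForward e he _ _ ih => exact mul_pos (one_pos.trans_le (hratio e he)) ih
  | compressorBackward e he _ _ ih => exact div_pos ih (one_pos.trans_le (hratio e he))
  | pipeForward e _ _ _ _ hsub _ => exact (hsub _ right_mem_uIcc).1
  | pipeBackward e _ _ _ _ hsub _ => exact (hsub _ left_mem_uIcc).1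

theorem PathPressure.extend_head (h : PathPressure G N B q η W (N.tail e) π) (hW : N.head e ∉ W)
    (hrel : EdgeRelation G N B q η e π π') :
    PathPressure G N B q η (insert (N.head e) W) (N.head e) π' := by
  by_cases he : e ∈ N.compressors
  · rw [hrel.1 he]
    exact .compressorForward e he hW h
  · exact .pipeForward e he hW h (hrel.2 he).1 (hrel.2 he).2

theorem PathPressure.extend_tail (hratio : ∀ e ∈ N.compressors, 1 ≤ B.ratio e)
    (h : PathPressure G N B q η W (N.head e) π) (hW : N.tail e ∉ W)
    (hrel : EdgeRelation G N B q η e π' π) :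
    PathPressure G N B q η (insert (N.tail e) W) (N.tail e) π' := by
  by_cases he : e ∈ N.compressors
  · have hr := one_pos.trans_le (hratio e he)
    rw [show π' = π / B.ratio e by rw [hrel.1 he]; field_simp]
    exact .compressorBackward e he hW h
  · exact .pipeBackward e he hW h (hrel.2 he).1 (hrel.2 he).2

variable [Fintype E]

/-- A flow and a composition as they occur in `SubsonicFlow`. -/
structure IsNoncirculating (N : GasNetwork V E) (B : BoundaryData V E) (q : E → ℝ)
    (η : V → ℝ) : Prop where
  massBalance : N.MassBalance B.load q
  not_circulates : ¬ N.Circulates q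
  composition : N.IsComposition B q η

theorem IsNoncirculating.edgeComposition_mem (h : IsNoncirculating N B q η) (e : E) :
    N.edgeComposition q η e ∈ Icc (0 : ℝ) 1 :=
  GasNetwork.edgeComposition_mem (fun v => (h.composition v).1) e

section Existence

variable (hZ : G.AdmissibleCompressibility) (hratio : ∀ e ∈ N.compressors, 1 ≤ B.ratio e)
  (hpressure : 0 < B.pressure) (hsubsonic : N.SubsonicFlow G B) (h : IsNoncirculating N B q η)

include hZ hratio hpressure hsubsonic h

theorem exists_head_pressure (hpath : PathPressure G N B q η W (N.tail e) π)
    (hW : N.head e ∉ W) : ∃ π', EdgeRelation G N B q η e π π' := by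
  by_cases he : e ∈ N.compressors
  · exact ⟨_, fun _ => rfl, fun h => absurd he h⟩
  · obtain ⟨π', h'⟩ := hZ.exists_pressure_of_staysSubsonicFromTail (h.edgeComposition_mem e)
      (N.length_pos e he).le (hpath.pos hratio hpressure)
      ((hsubsonic q η h.massBalance h.not_circulates h.composition W _ π hpath e he).1 rfl hW)
    exact ⟨π', fun h => absurd h he, fun _ => h'⟩

theorem exists_tail_pressure (hpath : PathPressure G N B q η W (N.head e) π)
    (hW : N.tail e ∉ W) : ∃ π', EdgeRelation G N B q η e π' π := by
  by_cases he : e ∈ N.compressors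
  · have hr := one_pos.trans_le (hratio e he)
    exact ⟨π / B.ratio e, fun _ => by field_simp, fun h => absurd he h⟩
  · obtain ⟨π', h'⟩ := hZ.exists_pressure_of_staysSubsonicFromHead (h.edgeComposition_mem e)
      (N.length_pos e he).le (hpath.pos hratio hpressure)
      ((hsubsonic q η h.massBalance h.not_circulates h.composition W _ π hpath e he).2 rfl hW)
    exact ⟨π', fun h => absurd h he, fun _ => h'⟩

/-- Pressures that satisfy the equations of the edges of a spanning tree. -/
theorem SpanningTree.exists_pressure (T : N.SpanningTree B.node) :
    ∃ p : V → ℝ, p B.node = B.pressure ∧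
      (∀ e ∈ T.edges, EdgeRelation G N B q η e (p (N.tail e)) (p (N.head e))) ∧
      ∀ v, ∃ W, PathPressure G N B q η W v (p v) ∧ ∀ u ∈ W, u = v ∨ T.depth u < T.depth v := by
  set R : V → ℝ → ℝ → Prop := fun v π π' =>
    (N.tail (T.par v) = T.up v ∧ N.head (T.par v) = v ∧ EdgeRelation G N B q η (T.par v) π π') ∨
    (N.head (T.par v) = T.up v ∧ N.tail (T.par v) = v ∧ EdgeRelation G N B q η (T.par v) π' π)
    with hR
  -- A far-end pressure is known to exist only for values reached along a path. The recursion
  -- therefore chooses blindly, and `hstep` shows afterwards that each choice succeeds.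
  obtain ⟨p, hp0, hp⟩ := T.exists_recursion B.pressure fun v π => Classical.epsilon (R v π)
  have hstep : ∀ v, v ≠ B.node → (∃ W, PathPressure G N B q η W (T.up v) (p (T.up v)) ∧
      ∀ u ∈ W, u = T.up v ∨ T.depth u < T.depth (T.up v)) →
      R v (p (T.up v)) (p v) ∧ ∃ W, PathPressure G N B q η W v (p v) ∧
        ∀ u ∈ W, u = v ∨ T.depth u < T.depth v := by
    rintro v hv ⟨W, hW, hWd⟩
    have hlt : ∀ u ∈ W, T.depth u < T.depth v := fun u hu => by
      rcases hWd u hu with rfl | h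
      · exact T.depth_up v hv
      · exact h.trans (T.depth_up v hv)
    -- All nodes on the path have smaller depth than `v`, so the extended path repeats no node.
    have hvW : v ∉ W := fun hvW => lt_irrefl _ (hlt v hvW)
    have hRv : R v (p (T.up v)) (p v) := by
      rw [hp v hv]
      apply Classical.epsilon_spec
      rcases T.joins v hv with ⟨h1, h2⟩ | ⟨h1, h2⟩
      · obtain ⟨π', hπ'⟩ := exists_head_pressure hZ hratio hpressure hsubsonic h (e := T.par v)
          (by rw [h1]; exact hW) (by rwa [h2])
        exact ⟨π', Or.inl ⟨h1, h2, hπ'⟩⟩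
      · obtain ⟨π', hπ'⟩ := exists_tail_pressure hZ hratio hpressure hsubsonic h (e := T.par v)
          (by rw [h1]; exact hW) (by rwa [h2])
        exact ⟨π', Or.inr ⟨h1, h2, hπ'⟩⟩
    refine ⟨hRv, insert v W, ?_, fun u hu => hu.imp id (hlt u)⟩
    rcases hRv with ⟨h1, h2, h3⟩ | ⟨h1, h2, h3⟩
    · have := PathPressure.extend_head (by rw [h1]; exact hW) (by rwa [h2]) h3
      rwa [h2] at this
    · have := PathPressure.extend_tail hratio (by rw [h1]; exact hW) (by rwa [h2]) h3
      rwa [h2] at this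
  have hall : ∀ v, ∃ W, PathPressure G N B q η W v (p v) ∧
      ∀ u ∈ W, u = v ∨ T.depth u < T.depth v :=
    T.induction (P := fun v => ∃ W, PathPressure G N B q η W v (p v) ∧
      ∀ u ∈ W, u = v ∨ T.depth u < T.depth v)
      ⟨{B.node}, hp0 ▸ .start, fun u hu => Or.inl hu⟩ fun v hv hv' => (hstep v hv hv').2
  refine ⟨p, hp0, ?_, hall⟩
  rintro _ ⟨v, hv, rfl⟩
  rcases (hstep v hv (hall _)).1 with ⟨h1, h2, h3⟩ | ⟨h1, h2, h3⟩
  · rwa [h1, h2]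
  · rwa [h1, h2]

end Existence

section Continuity

variable [Finite V] {I : Set ℝ} {qs : ℝ → E → ℝ} {ηs : ℝ → V → ℝ} {x y : ℝ → ℝ}

variable (hZ : G.AdmissibleCompressibility)
  (hqs : ∀ e, Continuous fun t => qs t e) (h : ∀ t ∈ I, IsNoncirculating N B (qs t) (ηs t))
  (hrel : ∀ t ∈ I, EdgeRelation G N B (qs t) (ηs t) e (x t) (y t))

include hZ hqs h hrel

theorem continuousOn_head_pressure (hx : ContinuousOn x I) : ContinuousOn y I := by
  by_cases he : e ∈ N.compressors
  · exact (continuousOn_const.mul hx).congr fun t ht => (hrel t ht).1 he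
  intro t ht
  refine (tendsto_iff_ultrafilter _ _ _).2 fun U hU => ?_
  have hI : ∀ᶠ s in U, s ∈ I := hU self_mem_nhdsWithin
  have hq : ∀ e, Tendsto (fun s => qs s e) U (𝓝 (qs t e)) := fun e =>
    ((hqs e).tendsto t).mono_left (hU.trans nhdsWithin_le_nhds)
  exact hZ.tendsto_pressure (hI.mono fun s hs => (h s hs).edgeComposition_mem e)
    (fun hne => tendsto_edgeComposition (h t ht).massBalance (h t ht).not_circulates
      (h t ht).composition hq (hI.mono fun s hs => (h s hs).composition) hne)
    ((h t ht).edgeComposition_mem e) (hq e) ((hx t ht).mono_left hU)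
    (hI.mono fun s hs => ((hrel s hs).2 he).1) (hI.mono fun s hs => ((hrel s hs).2 he).2)
    ((hrel t ht).2 he).1 ((hrel t ht).2 he).2

theorem continuousOn_tail_pressure (hratio : ∀ e ∈ N.compressors, 1 ≤ B.ratio e)
    (hy : ContinuousOn y I) : ContinuousOn x I := by
  by_cases he : e ∈ N.compressors
  · refine (hy.div_const (B.ratio e)).congr fun t ht => ?_
    have hr := one_pos.trans_le (hratio e he)
    change x t = y t / _
    rw [(hrel t ht).1 he]
    field_simp
  intro t ht
  refine (tendsto_iff_ultrafilter _ _ _).2 fun U hU => ?_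
  have hI : ∀ᶠ s in U, s ∈ I := hU self_mem_nhdsWithin
  have hq : ∀ e, Tendsto (fun s => qs s e) U (𝓝 (qs t e)) := fun e =>
    ((hqs e).tendsto t).mono_left (hU.trans nhdsWithin_le_nhds)
  exact hZ.tendsto_pressure (hI.mono fun s hs => (h s hs).edgeComposition_mem e)
    (fun hne => tendsto_edgeComposition (h t ht).massBalance (h t ht).not_circulates
      (h t ht).composition hq (hI.mono fun s hs => (h s hs).composition) (neg_ne_zero.1 hne))
    ((h t ht).edgeComposition_mem e) (hq e).neg ((hy t ht).mono_left hU)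
    (hI.mono fun s hs => MixtureGas.pressureLoss_neg_comm.2 ((hrel s hs).2 he).1)
    (hI.mono fun s hs => MixtureGas.subsonicBetween_neg_comm.2 ((hrel s hs).2 he).2)
    (MixtureGas.pressureLoss_neg_comm.2 ((hrel t ht).2 he).1)
    (MixtureGas.subsonicBetween_neg_comm.2 ((hrel t ht).2 he).2)

omit hrel in
theorem SpanningTree.continuousOn_pressure (hratio : ∀ e ∈ N.compressors, 1 ≤ B.ratio e)
    (T : N.SpanningTree B.node) {ps : ℝ → V → ℝ}
    (hnode : ∀ t ∈ I, ps t B.node = B.pressure)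
    (hrel : ∀ t ∈ I, ∀ e ∈ T.edges,
      EdgeRelation G N B (qs t) (ηs t) e (ps t (N.tail e)) (ps t (N.head e))) (v : V) :
    ContinuousOn (fun t => ps t v) I := by
  refine T.induction (P := fun v => ContinuousOn (fun t => ps t v) I)
    (continuousOn_const.congr hnode) (fun v hv ih => ?_) v
  have hrel := fun t ht => hrel t ht (T.par v) ⟨v, hv, rfl⟩
  rcases T.joins v hv with ⟨h1, h2⟩ | ⟨h1, h2⟩
  · rw [h1, h2] at hrel
    exact continuousOn_head_pressure hZ hqs h hrel ih
  · rw [h1, h2] at hrel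
    exact continuousOn_tail_pressure hZ hqs h hrel hratio ih

end Continuity

/-! ### Signs of the pressure differences around the cycle. -/

section Signs

/-- Summation by parts; for divergence-free `c` it says that potential differences around the cycle
cancel. -/
theorem sum_mul_head_sub_tail [Fintype V] (N : GasNetwork V E) (c : E → ℝ) (p : V → ℝ) :
    ∑ e, c e * (p (N.head e) - p (N.tail e)) = ∑ v, p v * N.divergence c v := by
  classical
  change _ = ∑ v, p v * ∑ e, _
  simp only [Finset.mul_sum]
  rw [Finset.sum_comm]
  refine Finset.sum_congr rfl fun e _ => ?_
  simp [mul_sub, Finset.sum_sub_distrib, mul_comm]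

variable (hZ : G.AdmissibleCompressibility) (h : IsNoncirculating N B q η) {c : E → ℝ}

include hZ h

theorem EdgeRelation.mul_sub_nonpos (hrel : EdgeRelation G N B q η e π π')
    (he : e ∉ N.compressors) (hsign : 0 ≤ c e * q e) : c e * (π' - π) ≤ 0 := by
  obtain ⟨h1, h2⟩ := hrel.2 he
  have hη := h.edgeComposition_mem e
  have hL := (N.length_pos e he).le
  rcases lt_trichotomy (c e) 0 with hc | hc | hc
  · have := hZ.tail_le_head hη hL (nonpos_of_mul_nonneg_right hsign hc) h1 h2
    exact mul_nonpos_of_nonpos_of_nonneg hc.le (sub_nonneg.2 this)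
  · simp [hc]
  · have := hZ.head_le_tail hη hL (nonneg_of_mul_nonneg_right hsign hc) h1 h2
    exact mul_nonpos_of_nonneg_of_nonpos hc.le (sub_nonpos.2 this)

/-- If the flow follows the cycle, the pressure decreases along all edges of the cycle but one, and
hence increases along the remaining edge. -/
theorem mul_sub_nonneg [Fintype V] (hc : N.divergence c = 0)
    (hcomp : ∀ e ∈ N.compressors, c e = 0) (hsign : ∀ e, 0 ≤ c e * q e) {p : V → ℝ} {e₀ : E}
    (hrel : ∀ e, e ≠ e₀ → EdgeRelation G N B q η e (p (N.tail e)) (p (N.head e))) :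
    0 ≤ c e₀ * (p (N.head e₀) - p (N.tail e₀)) := by
  classical
  have hsum := sum_mul_head_sub_tail N c p
  rw [hc, ← Finset.add_sum_erase _ _ (Finset.mem_univ e₀)] at hsum
  have : ∑ e ∈ Finset.univ.erase e₀, c e * (p (N.head e) - p (N.tail e)) ≤ 0 := by
    refine Finset.sum_nonpos fun e he => ?_
    by_cases hec : e ∈ N.compressors
    · simp [hcomp e hec]
    · exact (hrel e (Finset.ne_of_mem_erase he)).mul_sub_nonpos hZ h hec (hsign e)
  simp only [Pi.zero_apply, mul_zero, Finset.sum_const_zero] at hsum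
  linarith

end Signs

theorem isSteadyState_of_forall_edgeRelation (h : IsNoncirculating N B q η) {p : V → ℝ}
    (hpos : ∀ v, 0 < p v) (hnode : p B.node = B.pressure)
    (hrel : ∀ e, EdgeRelation G N B q η e (p (N.tail e)) (p (N.head e))) :
    N.IsSteadyState G B q η p ∧ N.IsSubsonicState G q η p :=
  ⟨⟨h.massBalance, h.composition, hpos, hnode, fun e he => (hrel e).1 he,
    fun e he => ((hrel e).2 he).1⟩, fun e he => ((hrel e).2 he).2⟩

omit [Fintype E] in
theorem eq_zero_of_loop (h : ¬ N.Circulates q) (he : N.tail e = N.head e) : q e = 0 := by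
  by_contra hne
  refine h ⟨0, fun _ => N.tail e, fun _ => e, Function.injective_of_subsingleton (α := Fin 1) _,
    Function.injective_of_subsingleton (α := Fin 1) _, fun _ => ?_⟩
  rcases lt_or_gt_of_ne hne with hq | hq
  · exact Or.inr ⟨he.symm, rfl, hq⟩
  · exact Or.inl ⟨rfl, he.symm, hq⟩

end GasNetwork

end GasMixture

end

/-! ### Closing the cycle by the intermediate value theorem. -/

open GasMixture GasNetwork in
theorem mainTheorem1 {V E : Type*} [Fintype V] [Fintype E]
    (G : GasMixture.MixtureGas) (hZ : G.AdmissibleCompressibility)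
    (N : GasMixture.GasNetwork V E) (hconn : N.IsConnected)
    (hcycle : ∃! C : Set E, N.IsCycle C)
    (hcomp : ∀ C : Set E, N.IsCycle C → Disjoint C N.compressors)
    (B : GasMixture.BoundaryData V E)
    (hload : ∑ v, B.load v = 0)
    (hsupply : ∀ v, B.load v ≤ 0 → B.supply v ∈ Set.Icc (0 : ℝ) 1)
    (hratio : ∀ e ∈ N.compressors, 1 ≤ B.ratio e)
    (hpressure : 0 < B.pressure)
    (hsubsonic : N.SubsonicFlow G B) :
    ∃ (q : E → ℝ) (η p : V → ℝ), N.IsSteadyState G B q η p ∧ N.IsSubsonicState G q η p := by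
  obtain ⟨C, hC, huniq⟩ := hcycle
  obtain ⟨c, hc, hcC, hc0⟩ := hC.exists_divergence_eq_zero
  have hccomp : ∀ e ∈ N.compressors, c e = 0 := fun e he =>
    hc0 e fun heC => Set.disjoint_left.1 (hcomp C hC) heC he
  have : Nonempty E := ⟨hC.nonempty.some⟩
  obtain ⟨T⟩ := hconn.nonempty_spanningTree B.node
  obtain ⟨q₀, hq₀⟩ := T.exists_massBalance hload
  set qs : ℝ → E → ℝ := fun t => q₀ + t • c with hqs
  have hqsc : ∀ e, Continuous fun t => qs t e := fun e => by
    simp only [hqs, Pi.add_apply, Pi.smul_apply, smul_eq_mul]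
    fun_prop
  have hbal : ∀ t, N.MassBalance B.load (qs t) := fun t => by
    rw [massBalance_iff, map_add, map_smul, hc, smul_zero, add_zero]
    exact massBalance_iff.1 hq₀
  have hprod : ∀ t, ∀ e ∈ C, c e * qs t e = c e ^ 2 * (t - -q₀ e / c e) := fun t e he => by
    have := hcC e he
    simp only [hqs, Pi.add_apply, Pi.smul_apply, smul_eq_mul]
    field_simp
    ring
  -- `-q₀ e / c e` is the parameter at which the flow in `e` vanishes. Between the extreme zeros,
  -- `e₁` follows and `e₂` opposes `c`, up to zero flow, which excludes circulation.
  obtain ⟨e₁, he₁, hmin⟩ := Set.exists_min_image C (fun e => -q₀ e / c e) C.toFinite hC.nonempty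
  obtain ⟨e₂, he₂, hmax⟩ := Set.exists_max_image C (fun e => -q₀ e / c e) C.toFinite hC.nonempty
  set a := -q₀ e₁ / c e₁
  set b := -q₀ e₂ / c e₂
  have hab : a ≤ b := hmin e₂ he₂
  choose ηs hηs using fun t => exists_isComposition hsupply (hbal t)
  have hvalid : ∀ t ∈ Set.Icc a b, IsNoncirculating N B (qs t) (ηs t) := fun t ht =>
    ⟨hbal t, not_circulates hC huniq hc hcC
      ⟨e₂, he₂, by
        rw [hprod t e₂ he₂]
        exact mul_nonpos_of_nonneg_of_nonpos (sq_nonneg _) (sub_nonpos.2 ht.2)⟩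
      ⟨e₁, he₁, by
        rw [hprod t e₁ he₁]
        exact mul_nonneg (sq_nonneg _) (sub_nonneg.2 ht.1)⟩, hηs t⟩
  have hsignb : ∀ e, 0 ≤ c e * qs b e := fun e => by
    by_cases he : e ∈ C
    · rw [hprod b e he]
      exact mul_nonneg (sq_nonneg _) (sub_nonneg.2 (hmax e he))
    · simp [hc0 e he]
  have hsigna : ∀ e, 0 ≤ (-c) e * qs a e := fun e => by
    by_cases he : e ∈ C
    · rw [Pi.neg_apply, neg_mul, hprod a e he, neg_nonneg]
      exact mul_nonpos_of_nonneg_of_nonpos (sq_nonneg _) (sub_nonpos.2 (hmin e he))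
    · simp [hc0 e he]
  have hnc : N.divergence (-c) = 0 := by rw [map_neg, hc, neg_zero]
  have hnccomp : ∀ e ∈ N.compressors, (-c) e = 0 := fun e he => by simp [hccomp e he]
  choose! ps hnode htree hpath using fun t (ht : t ∈ Set.Icc a b) =>
    T.exists_pressure hZ hratio hpressure hsubsonic (hvalid t ht)
  have hpos : ∀ t ∈ Set.Icc a b, ∀ v, 0 < ps t v := fun t ht v =>
    let ⟨_, hW, _⟩ := hpath t ht v
    hW.pos hratio hpressure
  have hcont := T.continuousOn_pressure hZ hqsc hvalid hratio hnode htree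
  have hamem : a ∈ Set.Icc a b := ⟨le_rfl, hab⟩
  have hbmem : b ∈ Set.Icc a b := ⟨hab, le_rfl⟩
  suffices hfin : ∃ t ∈ Set.Icc a b, ∀ e ∉ T.edges,
      EdgeRelation G N B (qs t) (ηs t) e (ps t (N.tail e)) (ps t (N.head e)) by
    obtain ⟨t, ht, hrel⟩ := hfin
    exact ⟨qs t, ηs t, ps t, isSteadyState_of_forall_edgeRelation (hvalid t ht) (hpos t ht)
      (hnode t ht) fun e => (em (e ∈ T.edges)).elim (htree t ht e) (hrel e)⟩
  by_cases hall : ∃ e₀, e₀ ∉ T.edges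
  swap
  · exact ⟨a, hamem, fun e he => absurd ⟨e, he⟩ hall⟩
  obtain ⟨e₀, he₀⟩ := hall
  have hone : ∀ e ∉ T.edges, e = e₀ := fun e he =>
    T.eq_of_not_mem_edges hC huniq hc hcC he he₀
  have hother : ∀ e, e ≠ e₀ → e ∈ T.edges := fun e he => by_contra fun h => he (hone e h)
  have hce₀ : c e₀ ≠ 0 := T.ne_zero_of_not_mem_edges hC huniq hc hcC he₀
  have hpipe : e₀ ∉ N.compressors := fun h => hce₀ (hccomp e₀ h)
  suffices hfin : ∃ t ∈ Set.Icc a b,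
      EdgeRelation G N B (qs t) (ηs t) e₀ (ps t (N.tail e₀)) (ps t (N.head e₀)) by
    obtain ⟨t, ht, hrel⟩ := hfin
    exact ⟨t, ht, fun e he => hone e he ▸ hrel⟩
  have hb := mul_sub_nonneg hZ (hvalid b hbmem) hc hccomp hsignb
    fun e he => htree b hbmem e (hother e he)
  have ha := mul_sub_nonneg hZ (hvalid a hamem) hnc hnccomp hsigna
    fun e he => htree a hamem e (hother e he)
  rw [Pi.neg_apply, neg_mul] at ha
  -- For a loop no path may enter `e₀`, but a loop is itself a cycle, so its flow is zero and its
  -- equation is trivial.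
  by_cases hloop : N.tail e₀ = N.head e₀
  · refine ⟨a, hamem, fun h => absurd h hpipe, fun _ => ?_⟩
    rw [eq_zero_of_loop (hvalid a hamem).not_circulates hloop, hloop]
    exact hZ.pressureLoss_zero ((hvalid a hamem).edgeComposition_mem e₀) _ (hpos a hamem _)
  -- Entering `e₀` at its end of smaller depth guarantees that the other end is not on the tree path
  -- used so far.
  rcases le_total (T.depth (N.tail e₀)) (T.depth (N.head e₀)) with hd | hd
  · have hex : ∀ t ∈ Set.Icc a b, ∃ y, EdgeRelation G N B (qs t) (ηs t) e₀ (ps t (N.tail e₀)) y :=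
      fun t ht => by
        obtain ⟨W, hW, hWd⟩ := hpath t ht (N.tail e₀)
        refine exists_head_pressure hZ hratio hpressure hsubsonic (hvalid t ht) hW fun hmem => ?_
        rcases hWd _ hmem with h | h
        · exact hloop h.symm
        · exact absurd hd (not_le.2 h)
    choose! y hy using hex
    have hyc := continuousOn_head_pressure hZ hqsc hvalid hy (hcont _)
    have hyb := (hy b hbmem).mul_sub_nonpos hZ (hvalid b hbmem) hpipe (hsignb e₀)
    have hya := (hy a hamem).mul_sub_nonpos hZ (hvalid a hamem) hpipe (hsigna e₀)
    rw [Pi.neg_apply, neg_mul] at hya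
    -- The mismatch at the head, weighted by `c e₀`, is at most zero at `a` by `ha` and `hya`, and
    -- at least zero at `b` by `hb` and `hyb`.
    obtain ⟨t, ht, h0⟩ := intermediate_value_Icc hab
      (f := fun t => c e₀ * (ps t (N.head e₀) - y t))
      (continuousOn_const.mul ((hcont _).sub hyc)) (show (0 : ℝ) ∈ Set.Icc _ _ from ⟨by linarith, by linarith⟩)
    have : ps t (N.head e₀) = y t := sub_eq_zero.1 ((mul_eq_zero.1 h0).resolve_left hce₀)
    exact ⟨t, ht, this ▸ hy t ht⟩
  · have hex : ∀ t ∈ Set.Icc a b, ∃ y, EdgeRelation G N B (qs t) (ηs t) e₀ y (ps t (N.head e₀)) :=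
      fun t ht => by
        obtain ⟨W, hW, hWd⟩ := hpath t ht (N.head e₀)
        refine exists_tail_pressure hZ hratio hpressure hsubsonic (hvalid t ht) hW fun hmem => ?_
        rcases hWd _ hmem with h | h
        · exact hloop h
        · exact absurd hd (not_le.2 h)
    choose! y hy using hex
    have hyc := continuousOn_tail_pressure hZ hqsc hvalid hy hratio (hcont _)
    have hyb := (hy b hbmem).mul_sub_nonpos hZ (hvalid b hbmem) hpipe (hsignb e₀)
    have hya := (hy a hamem).mul_sub_nonpos hZ (hvalid a hamem) hpipe (hsigna e₀)
    rw [Pi.neg_apply, neg_mul] at hya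
    obtain ⟨t, ht, h0⟩ := intermediate_value_Icc hab
      (f := fun t => c e₀ * (y t - ps t (N.tail e₀)))
      (continuousOn_const.mul (hyc.sub (hcont _))) (show (0 : ℝ) ∈ Set.Icc _ _ from ⟨by linarith, by linarith⟩)
    have : ps t (N.tail e₀) = y t := (sub_eq_zero.1 ((mul_eq_zero.1 h0).resolve_left hce₀)).symm
    exact ⟨t, ht, this ▸ hy t ht⟩
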